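/- Let $\mathbf{t} = t_0t_1t_2\cdots = 01101001\cdots$ be the Thue--Morse word, where $t_i \in \{0,1\}$ is the parity of the sum of the binary digits of $i$. For $n \ge 0$ let $c(n)$ be the number of length-$n$ factors (contiguous blocks $t_i t_{i+1}\cdots t_{i+n-1}$, $i \ge 0$) of $\mathbf{t}$, where factors that are equal up to a cyclic shift are counted only once. Put $$A = \{2^k - 1 : k \ge 1\}, \quad B = \{2^k + 1 : k \ge 2\}, \quad J = \{(2^{2i+1}+1)2^j : i \ge 1,\ j \ge 0\}.$$ Then: (i) $c(n) \ge \frac{4}{3} n - 4$ for all integers $n \ge 0$; (ii) $c(n) \ge \frac{4}{3} n - 2$ for all even $n \ge 0$ with $n \notin J$; (iii) $c(n) \ge \frac{4n+16}{3}$ for all odd $n \ge 47$ with $n \notin A \cup B$. -/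

import Mathlib

/-- The Thue-Morse word `t = 01101001...`: the letter `t n` is the parity of the sum of the binary
digits of `n`. -/
def thueMorse (n : ℕ) : Fin 2 := Fin.ofNat 2 (Nat.digits 2 n).sum

/-- The factor `x i, x (i + 1), ..., x (i + n - 1)` of length `n` of the infinite word `x` that
starts at position `i`. -/
def factorAt {α : Type*} (x : ℕ → α) (n i : ℕ) : List α := List.ofFn fun k : Fin n => x (i + k)

/-- The set of length-`n` factors of the infinite word `x` up to cyclic shift; `Cycle α` is the
quotient of `List α` by the relation of being a rotation of each other. -/
def cyclicFactors {α : Type*} (x : ℕ → α) (n : ℕ) : Set (Cycle α) :=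
  Set.range fun i : ℕ => (factorAt x n i : Cycle α)

/-- Over a finite alphabet the set counted by `cyclicComplexity` is finite, so that its `ncard` is
the true number of elements. -/
theorem cyclicFactors_finite {α : Type*} [Finite α] (x : ℕ → α) (n : ℕ) :
    (cyclicFactors x n).Finite := by
  refine (Set.finite_range fun v : Fin n → α => ((List.ofFn v : List α) : Cycle α)).subset ?_
  rintro _ ⟨i, rfl⟩
  exact ⟨fun k => x (i + k), rfl⟩

/-- The cyclic complexity of an infinite word over a finite alphabet: the number of its factors of
length `n`, where factors that agree up to cyclic shift are counted once. -/
noncomputable def cyclicComplexity {α : Type*} [Finite α] (x : ℕ → α) (n : ℕ) : ℕ :=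
  (cyclicFactors x n).ncard

/-- The set `{2 ^ k - 1 : k ≥ 1}`. -/
def setA : Set ℕ := {n | ∃ k : ℕ, 1 ≤ k ∧ n = 2 ^ k - 1}

/-- The set `{2 ^ k + 1 : k ≥ 2}`. -/
def setB : Set ℕ := {n | ∃ k : ℕ, 2 ≤ k ∧ n = 2 ^ k + 1}

/-- The set `{(2 ^ (2 i + 1) + 1) 2 ^ j : i ≥ 1, j ≥ 0}`. -/
def setJ : Set ℕ := {n | ∃ i j : ℕ, 1 ≤ i ∧ n = (2 ^ (2 * i + 1) + 1) * 2 ^ j}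

/-! Every factor of the Thue-Morse word is a `mu`-image with at most one letter cut off at each end,
and the block boundaries of a long factor are determined. Write c for the cyclic complexity, p(n)
for the number of factors of length n and d(n) for the number of those whose end letters differ.

Even length: the words `mu u` contribute c(m) classes. The words `a mu(v) a`, conjugate to `a a
mu(v)`, come from the factors of length m + 1 with distinct end letters; they are pairwise
non-conjugate and have a surplus of one letter. Hence c(2m) ≥ c(m) + d(m+1) (`two_mul_complexity`).

Odd length: every factor is conjugate to some `a mu(u)`, where `u a` or `ā u` is a factor. Each
condition has p(m+1) solutions; both hold at most d(m+2) + e(m) times, where e(m) ≤ 4 counts the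
pairs of extensions `b u`, `u a` that do not combine, and e(m) = 0 unless m = 3·2^j. Different pairs
are conjugate only through moves from `v a` to `ā v`, at most d(m+1) in number. Hence c(2m+1) ≥
2p(m+1) - d(m+1) - d(m+2) - e(m) (`two_mul_add_one_complexity`).

Now p is piecewise linear with breakpoints 4·2^j and 6·2^j (`numAll_eq`), and d is half of p plus a
correlation `corr`. Sums and differences of consecutive correlations obey a linear recursion along
binary digits, which bounds them sharply (`corr_bounds_lower_half`, `corr_bounds_upper_half`). The
resulting estimate comes closest to the line 4n/3 near n = 2^k ± 1, whence A and B. It drops to 4n/3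
- 4 at 2^k + 1 with k odd. Since d(m+1) ≥ 4m/3 (`numDiff_lower_bound`), doubling never increases the
deficit, and the bad lengths propagate only along J. -/

namespace ThueMorse

/-! ### The Thue-Morse morphism. -/

/-- The complementary letter. -/
def bar (a : Fin 2) : Fin 2 := 1 - a

@[simp] theorem bar_bar (a : Fin 2) : bar (bar a) = a := by revert a; decide

@[simp] theorem bar_ne (a : Fin 2) : bar a ≠ a := by revert a; decide

@[simp] theorem ne_bar (a : Fin 2) : a ≠ bar a := by revert a; decide

theorem eq_bar_of_ne {a b : Fin 2} (h : a ≠ b) : a = bar b := by revert a b; decide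

@[simp] theorem bar_inj {a b : Fin 2} : bar a = bar b ↔ a = b := by revert a b; decide

theorem bar_eq_iff {a b : Fin 2} : bar a = b ↔ a = bar b := by revert a b; decide

/-- The Thue-Morse morphism `0 ↦ 01`, `1 ↦ 10`. -/
def mu : List (Fin 2) → List (Fin 2)
  | [] => []
  | a :: l => a :: bar a :: mu l

@[simp] theorem mu_nil : mu [] = [] := rfl

@[simp] theorem mu_cons (a : Fin 2) (l : List (Fin 2)) : mu (a :: l) = a :: bar a :: mu l := rfl

@[simp] theorem mu_append (u v : List (Fin 2)) : mu (u ++ v) = mu u ++ mu v := by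
  induction u with
  | nil => rfl
  | cons a u ih => simp [ih]

@[simp] theorem length_mu (u : List (Fin 2)) : (mu u).length = 2 * u.length := by
  induction u with
  | nil => rfl
  | cons a u ih => simp [ih]; ring

theorem mu_injective : Function.Injective mu := by
  intro u
  induction u with
  | nil => intro v h; cases v with
    | nil => rfl
    | cons => simp at h
  | cons a u ih => intro v h; cases v with
    | nil => simp at h
    | cons b v => simp only [mu_cons, List.cons.injEq] at h ⊢; exact ⟨h.1, ih h.2.2⟩

@[simp] theorem mu_inj {u v : List (Fin 2)} : mu u = mu v ↔ u = v := mu_injective.eq_iff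

theorem mu_eq_nil {u : List (Fin 2)} : mu u = [] ↔ u = [] := by cases u <;> simp

/-- An even-length prefix of a `mu`-image splits it into two `mu`-images. -/
theorem mu_eq_append {u x y : List (Fin 2)} (h : mu u = x ++ y) (hx : Even x.length) :
    ∃ p q, u = p ++ q ∧ x = mu p ∧ y = mu q := by
  obtain ⟨k, hk⟩ := hx
  have hlen := congrArg List.length h
  simp only [length_mu, List.length_append] at hlen
  refine ⟨u.take k, u.drop k, (List.take_append_drop k u).symm, ?_⟩
  rw [← List.take_append_drop k u, mu_append] at h
  refine (List.append_inj h ?_).imp Eq.symm Eq.symm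
  rw [length_mu, List.length_take]; omega

/-- An odd-length prefix of a `mu`-image cuts one of its blocks. -/
theorem mu_eq_append_of_odd {u x y : List (Fin 2)} (h : mu u = x ++ y) (hx : Odd x.length) :
    ∃ p c q, u = p ++ c :: q ∧ x = mu p ++ [c] ∧ y = bar c :: mu q := by
  rcases List.eq_nil_or_concat' x with rfl | ⟨x', a, rfl⟩
  · simp at hx
  rw [List.append_assoc] at h
  simp only [List.length_append, List.length_cons, List.length_nil] at hx
  obtain ⟨p, q, rfl, rfl, hq⟩ := mu_eq_append h (by
    rw [Nat.odd_add_one, Nat.not_odd_iff_even] at hx; exact hx)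
  cases q with
  | nil => simp at hq
  | cons c q =>
    simp only [mu_cons, List.singleton_append, List.cons.injEq] at hq
    obtain ⟨rfl, rfl⟩ := hq
    exact ⟨p, a, q, rfl, rfl, rfl⟩

/-! ### Factors and their desubstitution. -/

theorem thueMorse_two_mul (i : ℕ) : thueMorse (2 * i) = thueMorse i := by
  rcases Nat.eq_zero_or_pos i with rfl | hi
  · rfl
  · unfold thueMorse; rw [Nat.digits_base_mul (by norm_num) hi]; simp

theorem thueMorse_two_mul_add_one (i : ℕ) : thueMorse (2 * i + 1) = bar (thueMorse i) := by
  unfold thueMorse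
  rw [Nat.digits_add_two_add_one, show (2 * i + 1) % 2 = 1 by omega,
    show (2 * i + 1) / 2 = i by omega, List.sum_cons]
  generalize (Nat.digits 2 i).sum = k
  rcases Nat.even_or_odd' k with ⟨j, rfl | rfl⟩
  · simp [Fin.ofNat, bar, Nat.add_mod]
  · simp [Fin.ofNat, bar, Nat.add_mod]

theorem factorAt_succ {α : Type*} (x : ℕ → α) (n i : ℕ) :
    factorAt x (n + 1) i = x i :: factorAt x n (i + 1) := by
  simp only [factorAt, List.ofFn_succ, Fin.val_zero, add_zero, Fin.val_succ]
  congr 2; funext k; congr 1; ring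

@[simp] theorem factorAt_zero {α : Type*} (x : ℕ → α) (i : ℕ) : factorAt x 0 i = [] := rfl

@[simp] theorem length_factorAt {α : Type*} (x : ℕ → α) (n i : ℕ) :
    (factorAt x n i).length = n := by simp [factorAt]

theorem factorAt_add {α : Type*} (x : ℕ → α) (m n i : ℕ) :
    factorAt x (m + n) i = factorAt x m i ++ factorAt x n (i + m) := by
  induction m generalizing i with
  | zero => simp
  | succ m ih =>
    rw [show m + 1 + n = m + n + 1 by ring, factorAt_succ, factorAt_succ, ih]
    simp [add_comm, add_left_comm]

theorem factorAt_two_mul (m i : ℕ) :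
    factorAt thueMorse (2 * m) (2 * i) = mu (factorAt thueMorse m i) := by
  induction m generalizing i with
  | zero => rfl
  | succ m ih =>
    rw [show 2 * (m + 1) = 2 * m + 1 + 1 by ring, factorAt_succ, factorAt_succ, factorAt_succ,
      thueMorse_two_mul, thueMorse_two_mul_add_one, show 2 * i + 1 + 1 = 2 * (i + 1) by ring, ih,
      mu_cons]

/-- The word `w` is a factor of the Thue-Morse word. -/
def IsFactor (w : List (Fin 2)) : Prop := ∃ i, factorAt thueMorse w.length i = w

theorem isFactor_factorAt (n i : ℕ) : IsFactor (factorAt thueMorse n i) := ⟨i, by simp⟩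

theorem IsFactor.left {u v : List (Fin 2)} (h : IsFactor (u ++ v)) : IsFactor u := by
  obtain ⟨i, hi⟩ := h
  rw [List.length_append, factorAt_add] at hi
  exact ⟨i, (List.append_inj hi (by simp)).1⟩

theorem IsFactor.right {u v : List (Fin 2)} (h : IsFactor (u ++ v)) : IsFactor v := by
  obtain ⟨i, hi⟩ := h
  rw [List.length_append, factorAt_add] at hi
  exact ⟨_, (List.append_inj hi (by simp)).2⟩

theorem IsFactor.tail {a : Fin 2} {v : List (Fin 2)} (h : IsFactor (a :: v)) : IsFactor v :=
  IsFactor.right (u := [a]) h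

theorem IsFactor.of_infix {u v : List (Fin 2)} (h : IsFactor v) (huv : u <:+: v) :
    IsFactor u := by
  obtain ⟨s, t, rfl⟩ := huv
  exact h.left.right

theorem IsFactor.mu {u : List (Fin 2)} (h : IsFactor u) : IsFactor (mu u) := by
  obtain ⟨i, hi⟩ := h
  rw [← hi, ← factorAt_two_mul]
  exact isFactor_factorAt _ _

theorem isFactor_mu_concat {u : List (Fin 2)} {y : Fin 2} (h : IsFactor (u ++ [y])) :
    IsFactor (ThueMorse.mu u ++ [y]) := by
  have := h.mu
  rw [mu_append, mu_cons] at this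
  exact IsFactor.left (v := [bar y]) (by simpa using this)

theorem isFactor_cons_mu {u : List (Fin 2)} {x : Fin 2} (h : IsFactor (x :: u)) :
    IsFactor (bar x :: ThueMorse.mu u) := h.mu.tail

theorem isFactor_cons_mu_concat {u : List (Fin 2)} {x y : Fin 2}
    (h : IsFactor (x :: (u ++ [y]))) : IsFactor (bar x :: (ThueMorse.mu u ++ [y])) := by
  have := h.mu.tail
  rw [mu_append, mu_cons] at this
  exact IsFactor.left (v := [bar y]) (by simpa using this)

/-- Desubstitution of factors of even length. -/
theorem IsFactor.cases_even {w : List (Fin 2)} {m : ℕ} (h : IsFactor w)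
    (hw : w.length = 2 * m + 2) :
    (∃ u, IsFactor u ∧ w = ThueMorse.mu u) ∨
      ∃ x v y, IsFactor (x :: (v ++ [y])) ∧ w = bar x :: (ThueMorse.mu v ++ [y]) := by
  obtain ⟨i, hi⟩ := h
  rw [hw] at hi
  obtain ⟨j, rfl | rfl⟩ := Nat.even_or_odd' i
  · left
    exact ⟨_, isFactor_factorAt (m + 1) j, by rw [← hi, ← factorAt_two_mul]; congr 1⟩
  · right
    refine ⟨thueMorse j, factorAt thueMorse m (j + 1), thueMorse (j + 1 + m), ?_, ?_⟩
    · have := isFactor_factorAt (m + 1 + 1) j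
      rwa [factorAt_succ, factorAt_add, factorAt_succ _ 0] at this
    · rw [← hi, factorAt_succ, factorAt_add, factorAt_succ _ 0, thueMorse_two_mul_add_one,
        show 2 * j + 1 + 1 = 2 * (j + 1) by ring, factorAt_two_mul, ← mul_add, thueMorse_two_mul,
        factorAt_zero]

/-- Desubstitution of factors of odd length. -/
theorem IsFactor.cases_odd {w : List (Fin 2)} {m : ℕ} (h : IsFactor w)
    (hw : w.length = 2 * m + 1) :
    (∃ u y, IsFactor (u ++ [y]) ∧ w = ThueMorse.mu u ++ [y]) ∨
      ∃ x v, IsFactor (x :: v) ∧ w = bar x :: ThueMorse.mu v := by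
  obtain ⟨i, hi⟩ := h
  rw [hw] at hi
  obtain ⟨j, rfl | rfl⟩ := Nat.even_or_odd' i
  · left
    refine ⟨factorAt thueMorse m j, thueMorse (j + m), ?_, ?_⟩
    · have := isFactor_factorAt (m + 1) j
      rwa [factorAt_add, factorAt_succ _ 0] at this
    · rw [← hi, factorAt_add, factorAt_succ _ 0, factorAt_two_mul, ← mul_add, thueMorse_two_mul,
        factorAt_zero]
  · right
    refine ⟨thueMorse j, factorAt thueMorse m (j + 1), ?_, ?_⟩
    · have := isFactor_factorAt (m + 1) j
      rwa [factorAt_succ] at this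
    · rw [← hi, factorAt_succ, thueMorse_two_mul_add_one,
        show 2 * j + 1 + 1 = 2 * (j + 1) by ring, factorAt_two_mul]

/-! ### Cubes of letters and uniqueness of block boundaries. -/

/-- The Thue-Morse word contains no cube of a letter. -/
theorem not_isFactor_cube (a : Fin 2) : ¬ IsFactor [a, a, a] := by
  intro h
  rcases h.cases_odd (m := 1) rfl with ⟨u, y, -, h⟩ | ⟨x, v, -, h⟩
  · rcases u with _ | ⟨b, u⟩
    · simp at h
    · simp only [mu_cons, List.cons_append, List.cons.injEq] at h
      exact ne_bar b (h.1.symm.trans h.2.1)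
  · rcases v with _ | ⟨b, u⟩
    · simp at h
    · simp only [mu_cons, List.cons.injEq] at h
      exact ne_bar b (h.2.1.symm.trans h.2.2.1)

theorem not_isFactor_cons_cube (a : Fin 2) (l : List (Fin 2)) : ¬ IsFactor (a :: a :: a :: l) :=
  fun h => not_isFactor_cube a (IsFactor.left (v := l) h)

theorem IsFactor.not_infix_cube {w : List (Fin 2)} (h : IsFactor w) (a : Fin 2) :
    ¬ [a, a, a] <:+: w := fun hw => not_isFactor_cube a (h.of_infix hw)

theorem IsFactor.replicate_length_le {k : ℕ} {a : Fin 2} (h : IsFactor (List.replicate k a)) :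
    k ≤ 2 := by
  by_contra! hk
  obtain ⟨j, rfl⟩ := Nat.exists_eq_add_of_le' hk
  exact not_isFactor_cons_cube a _ (by simpa [List.replicate_succ] using h)

/-- A word that factors into blocks in both ways is alternating. -/
theorem eq_replicate_of_mu_concat_eq {u v : List (Fin 2)} {b y : Fin 2}
    (h : mu v ++ [y] = b :: mu u) :
    v = List.replicate v.length b ∧ y = b ∧ u = List.replicate v.length (bar b) := by
  induction v generalizing u with
  | nil =>
    simp only [mu_nil, List.nil_append, List.cons.injEq] at h
    simp [h.1, mu_eq_nil.1 h.2.symm]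
  | cons c v ih =>
    rcases u with _ | ⟨a, u⟩
    · simp at h
    · simp only [mu_cons, List.cons_append, List.cons.injEq] at h
      obtain ⟨rfl, rfl, h⟩ := h
      rw [bar_bar] at h
      obtain ⟨h1, h2, h3⟩ := ih h
      simp only [List.length_cons, List.replicate_succ]
      exact ⟨by rw [← h1], h2, by rw [← h3]⟩

/-- A word that factors into blocks in both ways is alternating. -/
theorem eq_replicate_of_mu_eq {u v : List (Fin 2)} {b y : Fin 2}
    (h : mu u = b :: (mu v ++ [y])) :
    v = List.replicate v.length (bar b) ∧ y = bar b ∧ u = List.replicate (v.length + 1) b := by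
  rcases u with _ | ⟨c, u⟩
  · simp at h
  simp only [mu_cons, List.cons.injEq] at h
  obtain ⟨rfl, h⟩ := h
  obtain ⟨h1, h2, h3⟩ := eq_replicate_of_mu_concat_eq h.symm
  exact ⟨h1, h2, by rw [List.replicate_succ, ← bar_bar c, ← h3]⟩

/-- Readings of both parities make the word alternate, so its preimage is constant; as a factor it
would be the power of a letter with exponent at least 3. The next three lemmas are variants: they
differ in the parity of the length and in which preimage is known to be a factor. -/
theorem mu_ne_cons_mu_concat {u v : List (Fin 2)} {x y : Fin 2}
    (h : IsFactor (x :: (v ++ [y]))) (hv : 1 ≤ v.length) : mu u ≠ bar x :: (mu v ++ [y]) := by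
  intro e
  obtain ⟨h1, h2, -⟩ := eq_replicate_of_mu_eq e
  rw [h1, h2, bar_bar, ← List.replicate_succ', ← List.replicate_succ] at h
  have := h.replicate_length_le
  omega

theorem mu_concat_ne_cons_mu {u v : List (Fin 2)} {x y : Fin 2}
    (h : IsFactor (x :: v)) (hv : 2 ≤ v.length) : mu u ++ [y] ≠ bar x :: mu v := by
  intro e
  obtain ⟨-, -, h3⟩ := eq_replicate_of_mu_concat_eq e
  rw [h3, bar_bar, ← List.replicate_succ] at h
  have := h.replicate_length_le
  have := congrArg List.length h3
  rw [List.length_replicate] at this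
  omega

theorem mu_concat_ne_cons_mu_of_isFactor {u v : List (Fin 2)} {b y : Fin 2}
    (h : IsFactor (u ++ [y])) (hu : 2 ≤ u.length) : mu u ++ [y] ≠ b :: mu v := by
  intro e
  obtain ⟨h1, h2, -⟩ := eq_replicate_of_mu_concat_eq e
  rw [h1, h2, ← List.replicate_succ'] at h
  have := h.replicate_length_le
  omega

theorem mu_ne_cons_mu_concat_of_isFactor {u v : List (Fin 2)} {b y : Fin 2}
    (h : IsFactor u) (hu : 3 ≤ u.length) : mu u ≠ b :: (mu v ++ [y]) := by
  intro e
  obtain ⟨-, -, h3⟩ := eq_replicate_of_mu_eq e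
  rw [h3] at h hu
  have := h.replicate_length_le
  rw [List.length_replicate] at hu
  omega

/-! ### Factors counted by their end letters. -/

/-- The set of factors of length `n` of the Thue-Morse word. -/
def factors (n : ℕ) : Set (List (Fin 2)) := {w | w.length = n ∧ IsFactor w}

theorem finite_factors (n : ℕ) : (factors n).Finite :=
  (List.finite_length_eq (Fin 2) n).subset fun _ h => h.1

/-- The number of factors of length `n` whose first and last letters differ. -/
noncomputable def numDiff (n : ℕ) : ℕ := {w ∈ factors n | w.head? ≠ w.getLast?}.ncard

/-- The number of factors of length `n` whose first and last letters agree. -/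
noncomputable def numSame (n : ℕ) : ℕ := {w ∈ factors n | w.head? = w.getLast?}.ncard

/-- Drops the first and the last letter. -/
def trim (w : List (Fin 2)) : List (Fin 2) := w.tail.dropLast

theorem trim_mu (x y : Fin 2) (v : List (Fin 2)) :
    trim (mu (x :: (v ++ [y]))) = bar x :: (mu v ++ [y]) := by
  simp only [trim, mu_cons, mu_append, mu_nil, List.tail_cons]
  rw [show bar x :: (mu v ++ [y, bar y]) = (bar x :: (mu v ++ [y])) ++ [bar y] by simp,
    List.dropLast_concat]

theorem exists_eq_cons_concat {z : List (Fin 2)} (hz : 2 ≤ z.length) :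
    ∃ x v y, z = x :: (v ++ [y]) := by
  rcases z with _ | ⟨x, z⟩
  · simp at hz
  rcases List.eq_nil_or_concat' z with rfl | ⟨v, y, rfl⟩
  · simp at hz
  exact ⟨x, v, y, rfl⟩

theorem dropLast_mu (y : Fin 2) (v : List (Fin 2)) :
    (mu (v ++ [y])).dropLast = mu v ++ [y] := by
  simp only [mu_cons, mu_append, mu_nil]
  rw [show mu v ++ [y, bar y] = (mu v ++ [y]) ++ [bar y] by simp, List.dropLast_concat]

theorem tail_mu (x : Fin 2) (v : List (Fin 2)) : (mu (x :: v)).tail = bar x :: mu v := rfl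

theorem exists_eq_concat {z : List (Fin 2)} (hz : 1 ≤ z.length) :
    ∃ v y, z = v ++ [y] := by
  rcases List.eq_nil_or_concat' z with rfl | ⟨v, y, rfl⟩
  · simp at hz
  exact ⟨v, y, rfl⟩

theorem exists_eq_cons {z : List (Fin 2)} (hz : 1 ≤ z.length) :
    ∃ x v, z = x :: v := by
  rcases z with _ | ⟨x, z⟩
  · simp at hz
  exact ⟨x, z, rfl⟩

/-- Occurrences at even and at odd positions give the two summands; they are disjoint because the
block boundaries are unique. The predicate `Q` is left free so that equal and distinct end letters
are treated together. -/
theorem ncard_factors_even (Q : List (Fin 2) → Prop) {m : ℕ} (hm : 2 ≤ m) :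
    {w ∈ factors (2 * m) | Q w}.ncard =
      {u ∈ factors m | Q (mu u)}.ncard + {z ∈ factors (m + 1) | Q (trim (mu z))}.ncard := by
  have key : {w ∈ factors (2 * m) | Q w} = mu '' {u ∈ factors m | Q (mu u)} ∪
      (fun z => trim (mu z)) '' {z ∈ factors (m + 1) | Q (trim (mu z))} := by
    ext w
    constructor
    · rintro ⟨⟨hl, hw⟩, hQ⟩
      rcases hw.cases_even (m := m - 1) (by omega) with ⟨u, hu, rfl⟩ | ⟨x, v, y, hv, rfl⟩
      · left
        rw [length_mu] at hl
        exact ⟨u, ⟨⟨by omega, hu⟩, hQ⟩, rfl⟩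
      · right
        simp only [List.length_cons, List.length_append, length_mu, List.length_nil] at hl
        exact ⟨_, ⟨⟨by simp; omega, hv⟩, by rwa [trim_mu]⟩, trim_mu _ _ _⟩
    · rintro (⟨u, ⟨⟨hl, hu⟩, hQ⟩, rfl⟩ | ⟨z, ⟨⟨hl, hz⟩, hQ⟩, rfl⟩)
      · exact ⟨⟨by simp [hl], hu.mu⟩, hQ⟩
      · obtain ⟨x, v, y, rfl⟩ := exists_eq_cons_concat (z := z) (by omega)
        simp only [trim_mu] at hQ ⊢
        simp at hl
        exact ⟨⟨by simp; omega, isFactor_cons_mu_concat hz⟩, hQ⟩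
  rw [key, Set.ncard_union_eq _ (((finite_factors m).subset fun _ h => h.1).image _)
    (((finite_factors (m + 1)).subset fun _ h => h.1).image _),
    Set.ncard_image_of_injective _ mu_injective, Set.InjOn.ncard_image]
  · rintro z ⟨⟨hl, hz⟩, hQ⟩ z' ⟨⟨hl', hz'⟩, hQ'⟩ h
    obtain ⟨x, v, y, rfl⟩ := exists_eq_cons_concat (z := z) (by omega)
    obtain ⟨x', v', y', rfl⟩ := exists_eq_cons_concat (z := z') (by omega)
    simp only [trim_mu, List.cons.injEq, bar_inj] at h
    obtain ⟨h2, h3⟩ := List.append_inj' h.2 rfl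
    rw [h.1, mu_inj.1 h2, h3]
  · rw [Set.disjoint_left]
    rintro _ ⟨u, ⟨⟨hl, hu⟩, -⟩, rfl⟩ ⟨z, ⟨⟨hl', hz⟩, -⟩, h⟩
    obtain ⟨x, v, y, rfl⟩ := exists_eq_cons_concat (z := z) (by omega)
    simp only [trim_mu] at h
    simp at hl'
    exact mu_ne_cons_mu_concat hz (by omega) h.symm

theorem ncard_factors_odd (Q : List (Fin 2) → Prop) {m : ℕ} (hm : 2 ≤ m) :
    {w ∈ factors (2 * m + 1) | Q w}.ncard =
      {z ∈ factors (m + 1) | Q (mu z).dropLast}.ncard +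
        {z ∈ factors (m + 1) | Q (mu z).tail}.ncard := by
  have key : {w ∈ factors (2 * m + 1) | Q w} =
      (fun z => (mu z).dropLast) '' {z ∈ factors (m + 1) | Q (mu z).dropLast} ∪
      (fun z => (mu z).tail) '' {z ∈ factors (m + 1) | Q (mu z).tail} := by
    ext w
    constructor
    · rintro ⟨⟨hl, hw⟩, hQ⟩
      rcases hw.cases_odd hl with ⟨u, y, hu, rfl⟩ | ⟨x, v, hv, rfl⟩
      · left
        simp only [List.length_append, length_mu, List.length_cons, List.length_nil] at hl
        exact ⟨_, ⟨⟨by simp; omega, hu⟩, by rwa [dropLast_mu]⟩, dropLast_mu _ _⟩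
      · right
        simp only [List.length_cons, length_mu] at hl
        exact ⟨_, ⟨⟨by simp; omega, hv⟩, by rwa [tail_mu]⟩, tail_mu _ _⟩
    · rintro (⟨z, ⟨⟨hl, hz⟩, hQ⟩, rfl⟩ | ⟨z, ⟨⟨hl, hz⟩, hQ⟩, rfl⟩)
      · obtain ⟨v, y, rfl⟩ := exists_eq_concat (z := z) (by omega)
        simp only [dropLast_mu] at hQ ⊢
        simp at hl
        exact ⟨⟨by simp; omega, isFactor_mu_concat hz⟩, hQ⟩
      · obtain ⟨x, v, rfl⟩ := exists_eq_cons (z := z) (by omega)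
        simp only [tail_mu] at hQ ⊢
        simp at hl
        exact ⟨⟨by simp; omega, isFactor_cons_mu hz⟩, hQ⟩
  rw [key, Set.ncard_union_eq _ (((finite_factors (m + 1)).subset fun _ h => h.1).image _)
    (((finite_factors (m + 1)).subset fun _ h => h.1).image _),
    Set.InjOn.ncard_image, Set.InjOn.ncard_image]
  · rintro z ⟨⟨hl, hz⟩, hQ⟩ z' ⟨⟨hl', hz'⟩, hQ'⟩ h
    obtain ⟨x, v, rfl⟩ := exists_eq_cons (z := z) (by omega)
    obtain ⟨x', v', rfl⟩ := exists_eq_cons (z := z') (by omega)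
    simp only [tail_mu, List.cons.injEq, bar_inj, mu_inj] at h
    rw [h.1, h.2]
  · rintro z ⟨⟨hl, hz⟩, hQ⟩ z' ⟨⟨hl', hz'⟩, hQ'⟩ h
    obtain ⟨v, y, rfl⟩ := exists_eq_concat (z := z) (by omega)
    obtain ⟨v', y', rfl⟩ := exists_eq_concat (z := z') (by omega)
    simp only [dropLast_mu] at h
    obtain ⟨h2, h3⟩ := List.append_inj' h rfl
    rw [mu_inj.1 h2, h3]
  · rw [Set.disjoint_left]
    rintro _ ⟨z, ⟨⟨hl, hz⟩, -⟩, rfl⟩ ⟨z', ⟨⟨hl', hz'⟩, -⟩, h⟩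
    obtain ⟨v, y, rfl⟩ := exists_eq_concat (z := z) (by omega)
    obtain ⟨x, v', rfl⟩ := exists_eq_cons (z := z') (by omega)
    simp only [tail_mu, dropLast_mu] at h
    simp at hl'
    exact mu_concat_ne_cons_mu hz' (by omega) h.symm

theorem ncard_congr_factors {n : ℕ} {Q R : List (Fin 2) → Prop}
    (h : ∀ w, w.length = n → (Q w ↔ R w)) :
    {w ∈ factors n | Q w}.ncard = {w ∈ factors n | R w}.ncard := by
  congr 1; ext w; exact and_congr_right fun hw => h w hw.1

theorem getLast?_cons_concat (x y : Fin 2) (v : List (Fin 2)) :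
    (x :: (v ++ [y])).getLast? = some y := by
  rw [← List.cons_append, List.getLast?_concat]

/-- `mu` complements only the last letter and `trim ∘ mu` only the first, so both exchange equal and
distinct ends. In odd length neither or both are complemented, and the type is kept. -/
theorem head?_mu_eq_getLast?_mu {u : List (Fin 2)} (hu : 2 ≤ u.length) :
    (mu u).head? = (mu u).getLast? ↔ u.head? ≠ u.getLast? := by
  obtain ⟨x, v, y, rfl⟩ := exists_eq_cons_concat hu
  rw [mu_cons, mu_append, mu_cons, mu_nil,
    show x :: bar x :: (mu v ++ [y, bar y]) = (x :: bar x :: (mu v ++ [y])) ++ [bar y] by simp,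
    List.getLast?_concat, getLast?_cons_concat]
  simp only [List.cons_append, List.head?_cons, Option.some.injEq, ne_eq]
  exact ⟨fun h e => ne_bar y (e.symm.trans h), eq_bar_of_ne⟩

theorem head?_trim_mu_eq {u : List (Fin 2)} (hu : 2 ≤ u.length) :
    (trim (mu u)).head? = (trim (mu u)).getLast? ↔ u.head? ≠ u.getLast? := by
  obtain ⟨x, v, y, rfl⟩ := exists_eq_cons_concat hu
  rw [trim_mu, getLast?_cons_concat, getLast?_cons_concat]
  simp only [List.head?_cons, Option.some.injEq, ne_eq]
  rw [bar_eq_iff]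
  exact ⟨fun h e => ne_bar y (e.symm.trans h), eq_bar_of_ne⟩

theorem head?_dropLast_mu_eq {u : List (Fin 2)} (hu : 2 ≤ u.length) :
    (mu u).dropLast.head? = (mu u).dropLast.getLast? ↔ u.head? = u.getLast? := by
  obtain ⟨x, v, y, rfl⟩ := exists_eq_cons_concat hu
  rw [← List.cons_append, dropLast_mu, List.getLast?_concat, List.getLast?_concat]
  simp

theorem head?_tail_mu_eq {u : List (Fin 2)} (hu : 2 ≤ u.length) :
    (mu u).tail.head? = (mu u).tail.getLast? ↔ u.head? = u.getLast? := by
  obtain ⟨x, v, y, rfl⟩ := exists_eq_cons_concat hu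
  rw [tail_mu, mu_append, mu_cons, mu_nil,
    show bar x :: (mu v ++ [y, bar y]) = (bar x :: (mu v ++ [y])) ++ [bar y] by simp,
    List.getLast?_concat, getLast?_cons_concat]
  simp

theorem numDiff_two_mul {m : ℕ} (hm : 2 ≤ m) :
    numDiff (2 * m) = numSame m + numSame (m + 1) := by
  rw [numDiff, ncard_factors_even _ hm]
  congr 1
  · exact ncard_congr_factors fun w hw => by rw [ne_eq, head?_mu_eq_getLast?_mu (by omega), not_not]
  · exact ncard_congr_factors fun w hw => by rw [ne_eq, head?_trim_mu_eq (by omega), not_not]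

theorem numSame_two_mul {m : ℕ} (hm : 2 ≤ m) :
    numSame (2 * m) = numDiff m + numDiff (m + 1) := by
  rw [numSame, ncard_factors_even _ hm]
  congr 1
  · exact ncard_congr_factors fun w hw => head?_mu_eq_getLast?_mu (by omega)
  · exact ncard_congr_factors fun w hw => head?_trim_mu_eq (by omega)

theorem numDiff_two_mul_add_one {m : ℕ} (hm : 2 ≤ m) :
    numDiff (2 * m + 1) = 2 * numDiff (m + 1) := by
  rw [numDiff, ncard_factors_odd _ hm, two_mul]
  congr 1
  · exact ncard_congr_factors fun w hw => not_congr (head?_dropLast_mu_eq (by omega))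
  · exact ncard_congr_factors fun w hw => not_congr (head?_tail_mu_eq (by omega))

theorem numSame_two_mul_add_one {m : ℕ} (hm : 2 ≤ m) :
    numSame (2 * m + 1) = 2 * numSame (m + 1) := by
  rw [numSame, ncard_factors_odd _ hm, two_mul]
  congr 1
  · exact ncard_congr_factors fun w hw => head?_dropLast_mu_eq (by omega)
  · exact ncard_congr_factors fun w hw => head?_tail_mu_eq (by omega)

theorem ncard_factors (n : ℕ) : (factors n).ncard = numDiff n + numSame n := by
  rw [numDiff, numSame, ← Set.ncard_union_eq _ ((finite_factors n).subset fun _ h => h.1)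
    ((finite_factors n).subset fun _ h => h.1)]
  · congr 1; ext w; simp only [Set.mem_union, Set.mem_ofPred_eq, ← and_or_left]; tauto
  · rw [Set.disjoint_left]; exact fun w h h' => h.2 h'.2

/-! ### Factors of lengths two and three. -/

/-- The prefix of length 32 of the Thue-Morse word. -/
def prefix32 : List (Fin 2) := mu (mu (mu (mu (mu [0]))))

theorem factorAt_prefix32 : factorAt thueMorse 32 0 = prefix32 := by
  have h (m : ℕ) := factorAt_two_mul m 0
  rw [prefix32, h 16, h 8, h 4, h 2, h 1]
  rfl

theorem isFactor_of_infix_prefix32 {w : List (Fin 2)} (h : w <:+: prefix32) : IsFactor w :=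
  IsFactor.of_infix (factorAt_prefix32 ▸ isFactor_factorAt 32 0) h

theorem factors_two : factors 2 = ({[0, 0], [0, 1], [1, 0], [1, 1]} : Finset (List (Fin 2))) := by
  ext w
  constructor
  · rintro ⟨hl, -⟩
    obtain ⟨a, b, rfl⟩ := List.length_eq_two.1 hl
    clear hl; revert a b; decide
  · intro h
    have : ∀ w ∈ ({[0, 0], [0, 1], [1, 0], [1, 1]} : Finset (List (Fin 2))),
      w.length = 2 ∧ w <:+: prefix32 := by decide
    exact (this w h).imp_right isFactor_of_infix_prefix32

theorem factors_three : factors 3 = ({[0, 0, 1], [0, 1, 0], [0, 1, 1], [1, 0, 0], [1, 0, 1],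
    [1, 1, 0]} : Finset (List (Fin 2))) := by
  ext w
  constructor
  · rintro ⟨hl, h⟩
    obtain ⟨a, b, c, rfl⟩ := List.length_eq_three.1 hl
    have h0 := not_isFactor_cube 0
    have h1 := not_isFactor_cube 1
    clear hl
    fin_cases a <;> fin_cases b <;> fin_cases c <;>
      first | exact absurd h h0 | exact absurd h h1 | simp
  · intro h
    have : ∀ w ∈ ({[0, 0, 1], [0, 1, 0], [0, 1, 1], [1, 0, 0], [1, 0, 1], [1, 1, 0]} :
      Finset (List (Fin 2))), w.length = 3 ∧ w <:+: prefix32 := by decide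
    exact (this w h).imp_right isFactor_of_infix_prefix32

theorem numDiff_two : numDiff 2 = 2 := by
  rw [numDiff, factors_two, show {w ∈ ((_ : Finset (List (Fin 2))) : Set (List (Fin 2))) | _} = _
    from (Finset.coe_filter _ _).symm, Set.ncard_coe_finset]
  decide

theorem numSame_two : numSame 2 = 2 := by
  rw [numSame, factors_two, show {w ∈ ((_ : Finset (List (Fin 2))) : Set (List (Fin 2))) | _} = _
    from (Finset.coe_filter _ _).symm, Set.ncard_coe_finset]
  decide

theorem numDiff_three : numDiff 3 = 4 := by
  rw [numDiff, factors_three, show {w ∈ ((_ : Finset (List (Fin 2))) : Set (List (Fin 2))) | _} = _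
    from (Finset.coe_filter _ _).symm, Set.ncard_coe_finset]
  decide

theorem numSame_three : numSame 3 = 2 := by
  rw [numSame, factors_three, show {w ∈ ((_ : Finset (List (Fin 2))) : Set (List (Fin 2))) | _} = _
    from (Finset.coe_filter _ _).symm, Set.ncard_coe_finset]
  decide

/-! ### Conjugacy classes of even length. -/

theorem isRotated_iff_exists_append {α : Type*} {l l' : List α} :
    l ~r l' ↔ ∃ s t, l = s ++ t ∧ l' = t ++ s := by
  constructor
  · rintro ⟨n, rfl⟩
    exact ⟨_, _, (List.take_append_drop (n % l.length) l).symm,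
      List.rotate_eq_drop_append_take_mod⟩
  · rintro ⟨s, t, rfl, rfl⟩
    exact List.isRotated_append

theorem cyclicFactors_eq_image (n : ℕ) :
    cyclicFactors thueMorse n = (fun w : List (Fin 2) => (w : Cycle (Fin 2))) '' factors n := by
  ext c
  constructor
  · rintro ⟨i, rfl⟩
    exact ⟨_, ⟨length_factorAt _ _ _, isFactor_factorAt n i⟩, rfl⟩
  · rintro ⟨w, ⟨rfl, i, hi⟩, rfl⟩
    exact ⟨i, by simp only [hi]⟩

theorem ncard_image_le_ncard_image {α β γ : Type*} {S : Set α} (hS : S.Finite) {f : α → β}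
    {g : α → γ} (h : ∀ x ∈ S, ∀ y ∈ S, f x = f y → g x = g y) :
    (g '' S).ncard ≤ (f '' S).ncard := by
  rcases S.eq_empty_or_nonempty with rfl | ⟨x0, -⟩
  · simp
  have : Nonempty α := ⟨x0⟩
  choose! x hx hgx using fun c (hc : c ∈ g '' S) => hc
  refine Set.ncard_le_ncard_of_injOn (fun c => f (x c))
    (fun c hc => Set.mem_image_of_mem f (hx c hc)) (fun c hc c' hc' e => ?_) (hS.image _)
  rw [← hgx c hc, ← hgx c' hc']
  exact h _ (hx c hc) _ (hx c' hc') e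

theorem count_mu (a : Fin 2) (u : List (Fin 2)) : (mu u).count a = u.length := by
  induction u with
  | nil => rfl
  | cons b u ih =>
    rw [mu_cons, List.count_cons, List.count_cons, ih, List.length_cons]
    have : (if (bar b == a) = true then 1 else 0) + (if (b == a) = true then 1 else 0) = 1 := by
      clear ih; revert a b; decide
    omega

/-- If the `mu`-images of two factors are conjugate, then so are the factors. -/
theorem isRotated_of_mu_isRotated {u u' : List (Fin 2)} (hu : IsFactor u) (hl : 3 ≤ u.length)
    (h : mu u ~r mu u') : u ~r u' := by
  rw [isRotated_iff_exists_append] at h ⊢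
  obtain ⟨s, t, h1, h2⟩ := h
  rcases Nat.even_or_odd s.length with hs | hs
  · obtain ⟨p, q, rfl, rfl, rfl⟩ := mu_eq_append h1 hs
    rw [← mu_append, mu_inj] at h2
    exact ⟨p, q, rfl, h2⟩
  · exfalso
    obtain ⟨p, c, q, rfl, rfl, rfl⟩ := mu_eq_append_of_odd h1 hs
    -- A cut inside a block reads `mu u'` off its boundaries; then `u'` and `u` are constant, which
    -- a factor of length 3 cannot be.
    have e : mu u' = bar c :: (mu (q ++ p) ++ [c]) := by simpa using h2
    obtain ⟨h3, -, -⟩ := eq_replicate_of_mu_eq e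
    rw [bar_bar, List.eq_replicate_iff] at h3
    have : p ++ c :: q = List.replicate (p ++ c :: q).length c := by
      rw [List.eq_replicate_iff]
      refine ⟨rfl, fun b hb => ?_⟩
      have := h3.2 b
      simp only [List.mem_append, List.mem_cons] at hb this
      tauto
    rw [this] at hu
    have := hu.replicate_length_le
    omega

/-- A long factor changes its letter more than once. -/
theorem not_isFactor_replicate_append {j k : ℕ} {a b : Fin 2} (h : 5 ≤ j + k) :
    ¬ IsFactor (List.replicate j a ++ List.replicate k b) := by
  intro hf
  have h1 := hf.left.replicate_length_le
  have h2 := hf.right.replicate_length_le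
  omega

/-- The two readings are out of phase by one letter along `mu q`, which forces alternation there;
the extra `a` restores the phase, so `r` consists of whole blocks. -/
theorem append_mu_eq {q u' r : List (Fin 2)} {a : Fin 2} (h : mu q ++ a :: r = a :: mu u') :
    ∃ v, q = List.replicate q.length a ∧ u' = List.replicate q.length (bar a) ++ v ∧ r = mu v := by
  induction q generalizing u' with
  | nil => simp at h; exact ⟨u', by simp [h]⟩
  | cons c q ih =>
    rcases u' with _ | ⟨b, u'⟩
    · simp at h
    · simp only [mu_cons, List.cons_append, List.cons.injEq] at h
      obtain ⟨rfl, rfl, h⟩ := h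
      rw [bar_bar] at h
      obtain ⟨v, h1, h2, h3⟩ := ih h
      refine ⟨v, ?_, ?_, h3⟩
      · rw [List.length_cons, List.replicate_succ, ← h1]
      · rw [List.length_cons, List.replicate_succ, List.cons_append, ← h2]

/-- The cyclic word `a a mu(v)` has only one reading, if `v` is a long factor. -/
theorem eq_of_cons_cons_mu_isRotated {v v' : List (Fin 2)} {a : Fin 2} (hv : IsFactor v)
    (hl : 5 ≤ v.length) (h : a :: a :: mu v ~r a :: a :: mu v') : v = v' := by
  rw [isRotated_iff_exists_append] at h
  obtain ⟨s, t, h1, h2⟩ := h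
  rcases s with _ | ⟨b, _ | ⟨b', s⟩⟩
  · simp at h1 h2
    rw [← h1] at h2
    simpa using h2.symm
  · simp only [List.cons_append, List.nil_append, List.cons.injEq] at h1
    obtain ⟨rfl, rfl⟩ := h1
    simp only [List.cons_append, List.cons.injEq, true_and] at h2
    obtain ⟨h3, -, -⟩ := eq_replicate_of_mu_concat_eq h2.symm
    rw [h3] at hv
    have := hv.replicate_length_le
    omega
  · simp only [List.cons_append, List.cons.injEq] at h1
    obtain ⟨rfl, rfl, h1⟩ := h1
    rcases Nat.even_or_odd s.length with hs | hs
    · obtain ⟨p, q, rfl, rfl, rfl⟩ := mu_eq_append h1 hs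
      rcases q with _ | ⟨c, q⟩
      · simpa using h2.symm
      · simp only [mu_cons, List.cons_append, List.cons.injEq] at h2
        obtain ⟨rfl, h, -⟩ := h2
        exact absurd h (ne_bar _)
    -- The cut splits a block, so both sides alternate: `v` is a power of one letter followed by a
    -- power of the other, too long for a factor.
    · obtain ⟨p, c, q, rfl, rfl, rfl⟩ := mu_eq_append_of_odd h1 hs
      simp only [List.cons_append, List.cons.injEq] at h2
      obtain ⟨rfl, h2⟩ := h2
      obtain ⟨w, h3, -, h4⟩ := append_mu_eq h2.symm
      obtain ⟨h5, -, -⟩ := eq_replicate_of_mu_eq h4.symm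
      rw [bar_bar] at h5
      rw [h5, h3, ← List.singleton_append, ← List.append_assoc] at hv
      have hv' : IsFactor (List.replicate (p.length + 1) c ++ List.replicate q.length (bar c)) := by
        rw [List.replicate_succ']; exact hv
      simp at hl
      exact absurd hv' (not_isFactor_replicate_append (by omega))

/-- Letter counts separate the two families: `mu u` is balanced, while `a a mu(v)` has two more
letters `a` than `bar a`, which also recovers `a`. Words `trim (mu z)` with equal end letters of `z`
are rotations of words `mu u` and add nothing. The bound 6 makes `v`, of length `m - 1`, long enough
for `eq_of_cons_cons_mu_isRotated`. -/
theorem two_mul_complexity {m : ℕ} (hm : 6 ≤ m) :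
    cyclicComplexity thueMorse m + numDiff (m + 1) ≤ cyclicComplexity thueMorse (2 * m) := by
  have h1 : (fun u => ((mu u : List (Fin 2)) : Cycle (Fin 2))) '' factors m ⊆
      cyclicFactors thueMorse (2 * m) := by
    rw [cyclicFactors_eq_image]
    rintro _ ⟨u, ⟨hl, hu⟩, rfl⟩
    exact ⟨mu u, ⟨by simp [hl], hu.mu⟩, rfl⟩
  have h2 : (fun z => ((trim (mu z) : List (Fin 2)) : Cycle (Fin 2))) ''
      {z ∈ factors (m + 1) | z.head? ≠ z.getLast?} ⊆ cyclicFactors thueMorse (2 * m) := by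
    rw [cyclicFactors_eq_image]
    rintro _ ⟨z, ⟨⟨hl, hz⟩, -⟩, rfl⟩
    obtain ⟨x, v, y, rfl⟩ := exists_eq_cons_concat (z := z) (by omega)
    simp at hl
    exact ⟨_, ⟨by rw [trim_mu]; simp; omega, by
      rw [trim_mu]; exact isFactor_cons_mu_concat hz⟩, rfl⟩
  have hform : ∀ z ∈ {z ∈ factors (m + 1) | z.head? ≠ z.getLast?}, ∃ a v, z = bar a :: (v ++ [a]) ∧
      v.length = m - 1 ∧ IsFactor v ∧ ((trim (mu z) : List (Fin 2)) : Cycle (Fin 2)) =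
        ((a :: a :: mu v : List (Fin 2)) : Cycle (Fin 2)) := by
    rintro z ⟨⟨hl, hz⟩, hne⟩
    obtain ⟨x, v, y, rfl⟩ := exists_eq_cons_concat (z := z) (by omega)
    simp only [List.head?_cons, getLast?_cons_concat, ne_eq, Option.some.injEq] at hne
    obtain rfl := eq_bar_of_ne hne
    simp at hl
    refine ⟨y, v, rfl, by omega, hz.tail.left, ?_⟩
    rw [trim_mu, bar_bar, Cycle.coe_eq_coe, isRotated_iff_exists_append]
    exact ⟨y :: mu v, [y], rfl, rfl⟩
  have hcount (a b : Fin 2) (v : List (Fin 2)) :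
      (a :: a :: mu v).count b = v.length + if a = b then 2 else 0 := by
    rw [List.count_cons, List.count_cons, count_mu]
    by_cases hab : a = b <;> simp [hab]
  rw [cyclicComplexity, cyclicComplexity]
  refine le_trans ?_ (Set.ncard_le_ncard (Set.union_subset h1 h2) (cyclicFactors_finite _ _))
  rw [Set.ncard_union_eq _ ((finite_factors m).image _)
    (((finite_factors (m + 1)).subset fun _ h => h.1).image _)]
  · apply add_le_add
    · rw [cyclicFactors_eq_image]
      refine ncard_image_le_ncard_image (finite_factors m) ?_
      rintro u ⟨hl, hu⟩ u' - h
      rw [Cycle.coe_eq_coe] at h ⊢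
      exact isRotated_of_mu_isRotated hu (by omega) h
    · rw [Set.InjOn.ncard_image]
      · rfl
      · intro z hz z' hz' h
        obtain ⟨a, v, rfl, hl, hv, e⟩ := hform z hz
        obtain ⟨a', v', rfl, hl', hv', e'⟩ := hform z' hz'
        simp only at h
        rw [e, e', Cycle.coe_eq_coe] at h
        have hc := h.perm.count_eq a
        rw [hcount, hcount, hl, hl'] at hc
        have : a' = a := by by_contra hne; simp [hne] at hc
        subst this
        rw [eq_of_cons_cons_mu_isRotated hv (by omega) h]
  · rw [Set.disjoint_left]
    rintro _ ⟨u, ⟨hl, hu⟩, rfl⟩ ⟨z, hz, h⟩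
    obtain ⟨a, v, rfl, hl', hv, e⟩ := hform z hz
    simp only at h
    rw [e, Cycle.coe_eq_coe] at h
    have hc := h.perm.count_eq a
    rw [hcount, count_mu] at hc
    simp at hc
    omega

/-! ### One-letter extensions that do not combine. -/

/-- Triples of a word `u` and letters `b`, `a` such that `b u` and `u a` are factors and `b u a`
is not. -/
def nonExtensions (m : ℕ) : Set (Fin 2 × Fin 2 × List (Fin 2)) :=
  {x | x.2.2.length = m ∧ IsFactor (x.1 :: x.2.2) ∧ IsFactor (x.2.2 ++ [x.2.1]) ∧
    ¬ IsFactor (x.1 :: (x.2.2 ++ [x.2.1]))}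

theorem finite_nonExtensions (m : ℕ) : (nonExtensions m).Finite := by
  refine (Set.finite_univ.prod (Set.finite_univ.prod (List.finite_length_eq (Fin 2) m))).subset ?_
  rintro ⟨b, a, u⟩ h
  exact ⟨trivial, trivial, h.1⟩

theorem nonExtensions_two : nonExtensions 2 = ∅ := by
  rw [Set.eq_empty_iff_forall_notMem]
  rintro ⟨b, a, u⟩ ⟨hl, h1, h2, h3⟩
  obtain ⟨c, d, rfl⟩ := List.length_eq_two.1 hl
  have key : ∀ a b c d : Fin 2, b :: ([c, d] ++ [a]) <:+: prefix32 ∨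
      [b, b, b] <:+: [b, c, d] ∨ [a, a, a] <:+: [c, d, a] := by decide
  rcases key a b c d with h | h | h
  · exact h3 (isFactor_of_infix_prefix32 h)
  · exact h1.not_infix_cube _ h
  · exact h2.not_infix_cube _ h

theorem ncard_nonExtensions_three : (nonExtensions 3).ncard ≤ 4 := by
  have hsub : nonExtensions 3 ⊆ ({(0, 0, [0, 1, 0]), (1, 1, [0, 1, 0]), (0, 0, [1, 0, 1]),
      (1, 1, [1, 0, 1])} : Finset (Fin 2 × Fin 2 × List (Fin 2))) := by
    rintro ⟨b, a, u⟩ ⟨hl, h1, h2, h3⟩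
    obtain ⟨c, d, e, rfl⟩ := List.length_eq_three.1 hl
    have key : ∀ a b c d e : Fin 2, b :: ([c, d, e] ++ [a]) <:+: prefix32 ∨
        [d, d, d] <:+: [b, c, d, e] ∨ [d, d, d] <:+: [c, d, e, a] ∨
        (b, a, [c, d, e]) ∈ ({(0, 0, [0, 1, 0]), (1, 1, [0, 1, 0]), (0, 0, [1, 0, 1]),
          (1, 1, [1, 0, 1])} : Finset (Fin 2 × Fin 2 × List (Fin 2))) := by decide
    rcases key a b c d e with h | h | h | h
    · exact absurd (isFactor_of_infix_prefix32 h) h3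
    · exact absurd h (h1.not_infix_cube _)
    · exact absurd h (h2.not_infix_cube _)
    · exact h
  refine (Set.ncard_le_ncard hsub (Finset.finite_toSet _)).trans ?_
  rw [Set.ncard_coe_finset]
  decide

/-- The readings of `b u` and `u a` must be in phase. As `u` has odd length, one of the letters `b`,
`a` completes a block begun in `u`, so it is forced and `b u a` is a factor. -/
theorem nonExtensions_two_mul_add_one {k : ℕ} (hk : 2 ≤ k) : nonExtensions (2 * k + 1) = ∅ := by
  rw [Set.eq_empty_iff_forall_notMem]
  rintro ⟨b, a, u⟩ ⟨hl, h1, h2, h3⟩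
  simp only at hl h1 h2 h3
  rcases h1.cases_even (m := k) (by simp [hl]) with ⟨v, hv, e⟩ | ⟨x, v, y, hv, e⟩
  · rcases v with _ | ⟨c, v⟩
    · simp at e
    simp only [mu_cons, List.cons.injEq] at e
    obtain ⟨rfl, rfl⟩ := e
    rcases h2.cases_even (m := k) (by simp at hl ⊢; omega) with
      ⟨v', hv', e'⟩ | ⟨x', v', y', hv', e'⟩
    · have hl' := congrArg List.length e'
      simp at hl hl'
      rw [List.cons_append] at e'
      exact mu_ne_cons_mu_concat_of_isFactor hv' (by omega) e'.symm
    · rw [List.cons_append, List.cons.injEq, bar_inj] at e'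
      obtain ⟨rfl, e'⟩ := e'
      obtain ⟨e2, e3⟩ := List.append_inj' e' rfl
      rw [← mu_inj.1 e2, ← e3] at hv'
      exact h3 (isFactor_mu_concat (u := b :: v) hv')
  · simp only [List.cons.injEq] at e
    obtain ⟨rfl, rfl⟩ := e
    rcases h2.cases_even (m := k) (by simp at hl ⊢; omega) with
      ⟨v', hv', e'⟩ | ⟨x', v', y', hv', e'⟩
    · rw [List.append_assoc] at e'
      obtain ⟨p, q, rfl, e1, e2⟩ := mu_eq_append e'.symm (by simp)
      rcases q with _ | ⟨c, q⟩
      · simp at e2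
      simp only [mu_cons, List.cons_append, List.nil_append, List.cons.injEq] at e2
      obtain ⟨rfl, rfl, -⟩ := e2
      apply h3
      have := isFactor_cons_mu hv
      simpa using this
    · rw [← List.cons_append] at e'
      obtain ⟨e2, -⟩ := List.append_inj' e' rfl
      simp at hl
      exact mu_concat_ne_cons_mu_of_isFactor hv.tail (by omega) e2

/-- If the blocks are out of step with `u`, both `b` and `a` complete blocks and `b u a` is a
factor. So `u` is a `mu`-image and the triple descends. Repeated halving ends at length 2, where
there is none, or at an odd length, where only 3 survives. -/
theorem nonExtensions_two_mul_subset {k : ℕ} (hk : 2 ≤ k) :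
    nonExtensions (2 * k) ⊆ (fun x => (bar x.1, x.2.1, mu x.2.2)) '' nonExtensions k := by
  rintro ⟨b, a, u⟩ ⟨hl, h1, h2, h3⟩
  simp only at hl h1 h2 h3
  rcases h1.cases_odd (m := k) (by simp [hl]) with ⟨v, y, hv, e⟩ | ⟨x, v, hv, e⟩
  · exfalso
    have hlv := congrArg List.length e
    simp [hl] at hlv
    rcases h2.cases_odd (m := k) (by simp [hl]) with ⟨v', y', hv', e'⟩ | ⟨x', v', hv', e'⟩
    · obtain ⟨rfl, -⟩ := List.append_inj' e' rfl
      exact mu_concat_ne_cons_mu_of_isFactor hv (by omega) e.symm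
    · rcases v with _ | ⟨c, v⟩
      · simp at hlv; omega
      simp only [mu_cons, List.cons_append, List.cons.injEq] at e
      obtain ⟨rfl, rfl⟩ := e
      simp only [List.cons_append, List.cons.injEq, List.append_assoc] at e'
      obtain ⟨p, q, rfl, e1, e2⟩ := mu_eq_append e'.2.symm (by simp)
      rcases q with _ | ⟨c, q⟩
      · simp at e2
      simp only [mu_cons, List.nil_append, List.cons.injEq] at e2
      obtain ⟨rfl, rfl, -⟩ := e2
      apply h3
      simpa using hv.mu
  · simp only [List.cons.injEq] at e
    obtain ⟨rfl, rfl⟩ := e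
    simp at hl
    rcases h2.cases_odd (m := k) (by simp [hl]) with ⟨v', y', hv', e'⟩ | ⟨x', v', hv', e'⟩
    · obtain ⟨e1, e2⟩ := List.append_inj' e' rfl
      rw [← mu_inj.1 e1, ← e2] at hv'
      exact ⟨(x, a, v), ⟨hl, hv, hv', fun h => h3 (isFactor_cons_mu_concat h)⟩, rfl⟩
    · have hlv := congrArg List.length e'
      simp [hl] at hlv
      exact absurd e' (mu_concat_ne_cons_mu hv' (by omega))

theorem ncard_nonExtensions_le (m : ℕ) (hm : 2 ≤ m) : (nonExtensions m).ncard ≤ 4 := by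
  induction m using Nat.strong_induction_on with
  | _ m ih =>
    obtain ⟨k, rfl | rfl⟩ := Nat.even_or_odd' m
    · rcases Nat.lt_or_ge k 2 with hk | hk
      · obtain rfl : k = 1 := by omega
        simp [nonExtensions_two]
      · exact (Set.ncard_le_ncard (nonExtensions_two_mul_subset hk)
          ((finite_nonExtensions k).image _)).trans
          ((Set.ncard_image_le (finite_nonExtensions k)).trans (ih k (by omega) hk))
    · rcases Nat.lt_or_ge k 2 with hk | hk
      · obtain rfl : k = 1 := by omega
        exact ncard_nonExtensions_three
      · simp [nonExtensions_two_mul_add_one hk]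

theorem exists_eq_of_nonExtensions_ne_empty (m : ℕ) (hm : 2 ≤ m) (h : nonExtensions m ≠ ∅) :
    ∃ j, m = 3 * 2 ^ j := by
  induction m using Nat.strong_induction_on with
  | _ m ih =>
    obtain ⟨k, rfl | rfl⟩ := Nat.even_or_odd' m
    · rcases Nat.lt_or_ge k 2 with hk | hk
      · obtain rfl : k = 1 := by omega
        exact absurd nonExtensions_two h
      · obtain ⟨j, hj⟩ := ih k (by omega) hk (by
          intro h0
          have := nonExtensions_two_mul_subset hk
          rw [h0, Set.image_empty, Set.subset_empty_iff] at this
          exact h this)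
        exact ⟨j + 1, by rw [hj, pow_succ]; ring⟩
    · rcases Nat.lt_or_ge k 2 with hk | hk
      · obtain rfl : k = 1 := by omega
        exact ⟨0, rfl⟩
      · exact absurd (nonExtensions_two_mul_add_one hk) h

/-! ### Conjugacy classes of odd length. -/

/-- A cut at an odd place is `a mu(p) | mu(q)`; exchanging the parts gives `mu(q) a mu(p)`, which
begins with `a` followed by blocks only if `q` is a power of `a`. -/
theorem exists_eq_of_cons_mu_eq {u u' s t : List (Fin 2)} {a : Fin 2} (h1 : a :: mu u = s ++ t)
    (h2 : a :: mu u' = t ++ s) (hs : Odd s.length) :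
    ∃ p k, u = p ++ List.replicate k a ∧ u' = List.replicate k (bar a) ++ p := by
  rcases s with _ | ⟨b, s⟩
  · simp at hs
  simp only [List.cons_append, List.cons.injEq] at h1
  obtain ⟨rfl, h1⟩ := h1
  rw [List.length_cons, Nat.odd_add_one, Nat.not_odd_iff_even] at hs
  obtain ⟨p, q, rfl, rfl, rfl⟩ := mu_eq_append h1 hs
  obtain ⟨v, h3, h4, h5⟩ := append_mu_eq h2.symm
  rw [← mu_inj.1 h5] at h4
  exact ⟨p, q.length, by rw [← h3], h4⟩

/-- Different readings of a cyclic word of odd length. -/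
theorem exists_eq_of_cons_mu_isRotated {u u' : List (Fin 2)} {a : Fin 2}
    (h : a :: mu u ~r a :: mu u') :
    ∃ p k, (u = p ++ List.replicate k a ∧ u' = List.replicate k (bar a) ++ p) ∨
      (u' = p ++ List.replicate k a ∧ u = List.replicate k (bar a) ++ p) := by
  obtain ⟨s, t, h1, h2⟩ := isRotated_iff_exists_append.1 h
  rcases Nat.even_or_odd s.length with hs | hs
  · obtain ⟨p, k, hp⟩ := exists_eq_of_cons_mu_eq h2 h1 (by
      have hl := congrArg List.length h1
      simp only [List.length_cons, length_mu, List.length_append] at hl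
      rcases Nat.even_or_odd t.length with ht | ht
      · have := hs.add ht
        rw [← hl, Nat.even_add_one] at this
        exact absurd (even_two_mul _) this
      · exact ht)
    exact ⟨p, k, Or.inr hp⟩
  · obtain ⟨p, k, hp⟩ := exists_eq_of_cons_mu_eq h1 h2 hs
    exact ⟨p, k, Or.inl hp⟩

/-- Pairs `(a, u)` for which the cyclic word `a mu(u)` is the class of a factor. -/
def readings (m : ℕ) : Set (Fin 2 × List (Fin 2)) :=
  {x | x.2.length = m ∧ (IsFactor (x.2 ++ [x.1]) ∨ IsFactor (bar x.1 :: x.2))}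

theorem finite_readings (m : ℕ) : (readings m).Finite := by
  refine (Set.finite_univ.prod (List.finite_length_eq (Fin 2) m)).subset ?_
  rintro ⟨a, u⟩ h
  exact ⟨trivial, h.1⟩

/-- One pair for each class of readings. -/
def minimalReadings (m : ℕ) : Set (Fin 2 × List (Fin 2)) :=
  {x | x ∈ readings m ∧ ∀ v, x.2 = v ++ [x.1] → (x.1, bar x.1 :: v) ∉ readings m}

/-- Minimality excludes a single move. For two moves, the absence of cubes makes the intermediate
word a reading too, so the first move is already excluded; three or more moves create a cube. -/
theorem eq_of_minimalReadings {m k : ℕ} {a : Fin 2} {p : List (Fin 2)}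
    (h : (a, p ++ List.replicate k a) ∈ minimalReadings m)
    (h' : (a, List.replicate k (bar a) ++ p) ∈ readings m) :
    p ++ List.replicate k a = List.replicate k (bar a) ++ p := by
  rcases k with _ | _ | _ | k
  · simp
  · exact absurd h' (h.2 p rfl)
  · exfalso
    refine h.2 (p ++ [a]) (by simp [List.replicate_succ]) ⟨?_, Or.inr ?_⟩
    · have := h.1.1
      simp at this ⊢
      omega
    · rcases h'.2 with h1 | h1
      · simpa [List.replicate_succ] using h1
      · exact absurd (by simpa [List.replicate_succ] using h1) (not_isFactor_cons_cube (bar a) p)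
  · exfalso
    have h1 : IsFactor (List.replicate (k + 1 + 1 + 1) (bar a)) := by
      rcases h'.2 with h1 | h1
      · exact h1.left.left
      · exact h1.tail.left
    have := h1.replicate_length_le
    omega

/-- This bounds the number of moves by factors with distinct ends. Only the case of factors `v a a`
and `ā ā v` is in doubt. A double letter straddles a block boundary: for `v` of even length the
final `ā` of `v` opens a block that `a` completes, and for odd length the phases at the two ends of
`v` conflict. -/
theorem isFactor_of_mem_readings {m : ℕ} {a : Fin 2} {v : List (Fin 2)} (hm : 5 ≤ m)
    (hl : v.length = m) (h1 : (a, v ++ [a]) ∈ readings (m + 1))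
    (h2 : (a, bar a :: v) ∈ readings (m + 1)) : IsFactor (bar a :: (v ++ [a])) := by
  rcases h1.2 with h1 | h1
  swap
  · exact h1
  rcases h2.2 with h2 | h2
  · simpa using h2
  simp only [List.append_assoc, List.cons_append, List.nil_append] at h1 h2
  obtain ⟨v1, d, rfl⟩ := exists_eq_concat (z := v) (by omega)
  have hd : d = bar a := by
    apply eq_bar_of_ne
    rintro rfl
    exact h1.not_infix_cube d ⟨v1, [], by simp⟩
  subst hd
  obtain ⟨j, hj | hj⟩ := Nat.even_or_odd' m
  · rcases h2.cases_even (m := j) (by simp at hl ⊢; omega) with ⟨z, hz, e⟩ | ⟨x, z, y, hz, e⟩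
    · rcases z with _ | ⟨c, z⟩
      · simp at e
      · simp only [mu_cons, List.cons.injEq] at e
        obtain ⟨rfl, e, -⟩ := e
        exact absurd e (ne_bar _)
    · rw [List.cons.injEq] at e
      obtain ⟨-, e⟩ := e
      rw [← List.cons_append] at e
      obtain ⟨e1, e2⟩ := List.append_inj' e rfl
      obtain rfl : bar a = y := by simpa using e2
      have := hz.tail.mu
      rw [mu_append, ← e1] at this
      simpa using this
  · rcases h2.cases_odd (m := j + 1) (by simp at hl ⊢; omega) with ⟨z, y, hz, e⟩ | ⟨x, z, hz, e⟩
    · exfalso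
      rcases z with _ | ⟨c, z⟩
      · simp at e
      · simp only [mu_cons, List.cons.injEq, List.cons_append] at e
        obtain ⟨rfl, e, -⟩ := e
        exact absurd e (ne_bar _)
    · rw [List.cons.injEq] at e
      rcases h1.cases_odd (m := j + 1) (by simp at hl ⊢; omega) with
        ⟨z', y', hz', e'⟩ | ⟨x', z', hz', e'⟩
      · have e'' : (v1 ++ [bar a, a]) ++ [a] = mu z' ++ [y'] := by simpa using e'
        obtain ⟨e1, -⟩ := List.append_inj' e'' rfl
        have e3 : mu z ++ [a] = bar a :: mu z' := by rw [← e1, ← e.2]; simp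
        have hl2 := congrArg List.length e.2
        simp at hl2 hl
        obtain ⟨e4, -, -⟩ := eq_replicate_of_mu_concat_eq e3
        have hz2 := hz.tail
        rw [e4] at hz2
        have := hz2.replicate_length_le
        omega
      · obtain ⟨z1, c, rfl⟩ := exists_eq_concat (z := z') (by
          have hl2 := congrArg List.length e'
          simp at hl2 hl
          omega)
        have e3 : (v1 ++ [bar a]) ++ [a, a] = (bar x' :: mu z1) ++ [c, bar c] := by
          simpa using e'
        obtain ⟨-, e4⟩ := List.append_inj' e3 rfl
        simp only [List.cons.injEq, and_true] at e4
        obtain ⟨rfl, e4⟩ := e4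
        exact absurd e4 (ne_bar _)

/-- Inclusion-exclusion counts the readings; removing one for each possible move leaves the minimal
ones, which inject into the classes. -/
theorem two_mul_add_one_complexity {m : ℕ} (hm : 6 ≤ m) :
    2 * (factors (m + 1)).ncard ≤ cyclicComplexity thueMorse (2 * m + 1) + numDiff (m + 1) +
      numDiff (m + 2) + (nonExtensions m).ncard := by
  obtain ⟨l, rfl⟩ : ∃ l, m = l + 1 := ⟨m - 1, by omega⟩
  have hT : (minimalReadings (l + 1)).ncard ≤ cyclicComplexity thueMorse (2 * (l + 1) + 1) := by
    refine Set.ncard_le_ncard_of_injOn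
      (fun x => ((x.1 :: mu x.2 : List (Fin 2)) : Cycle (Fin 2))) ?_ ?_ (cyclicFactors_finite _ _)
    · rintro ⟨a, u⟩ ⟨⟨hl, h⟩, -⟩
      simp only at hl h
      rw [cyclicFactors_eq_image]
      rcases h with h | h
      · refine ⟨mu u ++ [a], ⟨by simp [hl], isFactor_mu_concat h⟩, ?_⟩
        simp only
        rw [Cycle.coe_eq_coe, isRotated_iff_exists_append]
        exact ⟨mu u, [a], rfl, rfl⟩
      · refine ⟨a :: mu u, ⟨by simp [hl], ?_⟩, rfl⟩
        simpa using isFactor_cons_mu h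
    · rintro ⟨a, u⟩ hu ⟨a', u'⟩ hu' h
      simp only at h
      rw [Cycle.coe_eq_coe] at h
      have hc := h.perm.count_eq a
      rw [List.count_cons, List.count_cons, count_mu, count_mu, hu.1.1, hu'.1.1] at hc
      obtain rfl : a' = a := by by_contra hne; simp [hne] at hc
      obtain ⟨p, k, ⟨rfl, rfl⟩ | ⟨rfl, rfl⟩⟩ := exists_eq_of_cons_mu_isRotated h
      · rw [eq_of_minimalReadings hu hu'.1]
      · rw [eq_of_minimalReadings hu' hu.1]
  have hS : (readings (l + 1)).ncard ≤ (minimalReadings (l + 1)).ncard + numDiff (l + 1 + 1) := by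
    have hE : {x : Fin 2 × List (Fin 2) | x.2.length = l ∧ (x.1, x.2 ++ [x.1]) ∈ readings (l + 1) ∧
        (x.1, bar x.1 :: x.2) ∈ readings (l + 1)}.ncard ≤ numDiff (l + 1 + 1) := by
      refine Set.ncard_le_ncard_of_injOn (fun x => bar x.1 :: (x.2 ++ [x.1])) ?_ ?_
        ((finite_factors _).subset fun _ h => h.1)
      · rintro ⟨a, v⟩ ⟨hl, h1, h2⟩
        refine ⟨⟨by simpa using hl, isFactor_of_mem_readings (by omega) hl h1 h2⟩, ?_⟩
        rw [getLast?_cons_concat]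
        simp
      · rintro ⟨a, v⟩ - ⟨a', v'⟩ - h
        simp only [List.cons.injEq, bar_inj] at h
        rw [h.1, (List.append_inj' h.2 rfl).1]
    refine le_trans ?_ (add_le_add_right hE _)
    refine (Set.ncard_le_ncard (t := minimalReadings (l + 1) ∪ (fun x => (x.1, x.2 ++ [x.1])) ''
      {x : Fin 2 × List (Fin 2) | x.2.length = l ∧ (x.1, x.2 ++ [x.1]) ∈ readings (l + 1) ∧
        (x.1, bar x.1 :: x.2) ∈ readings (l + 1)}) ?_ ?_).trans ((Set.ncard_union_le _ _).trans ?_)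
    · rintro ⟨a, u⟩ h
      by_cases hm : (a, u) ∈ minimalReadings (l + 1)
      · exact Or.inl hm
      · right
        simp only [minimalReadings, Set.mem_ofPred_eq, not_and, not_forall, not_not] at hm
        obtain ⟨v, rfl, hv⟩ := hm h
        have := h.1
        exact ⟨(a, v), ⟨by simpa using this, h, hv⟩, rfl⟩
    · refine Set.Finite.union ((finite_readings _).subset fun _ h => h.1) (Set.Finite.image _ ?_)
      exact (Set.finite_univ.prod (List.finite_length_eq (Fin 2) l)).subset
        fun x h => ⟨trivial, h.1⟩
    · refine Nat.add_le_add_left (Set.ncard_image_le ?_) _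
      exact (Set.finite_univ.prod (List.finite_length_eq (Fin 2) l)).subset
        fun x h => ⟨trivial, h.1⟩
  have hA : {x : Fin 2 × List (Fin 2) | x.2.length = l + 1 ∧ IsFactor (x.2 ++ [x.1])}.ncard =
      (factors (l + 1 + 1)).ncard := by
    refine Set.ncard_congr (fun x _ => x.2 ++ [x.1]) ?_ ?_ ?_
    · rintro ⟨a, u⟩ ⟨hl, h⟩
      exact ⟨by simpa using hl, h⟩
    · rintro ⟨a, u⟩ ⟨a', u'⟩ - - h
      obtain ⟨h1, h2⟩ := List.append_inj' h rfl
      simp only [List.cons.injEq, and_true] at h1 h2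
      rw [h1, h2]
    · rintro w ⟨hl, h⟩
      obtain ⟨u, a, rfl⟩ := exists_eq_concat (z := w) (by omega)
      exact ⟨(a, u), ⟨by simpa using hl, h⟩, rfl⟩
  have hB : {x : Fin 2 × List (Fin 2) | x.2.length = l + 1 ∧ IsFactor (bar x.1 :: x.2)}.ncard =
      (factors (l + 1 + 1)).ncard := by
    refine Set.ncard_congr (fun x _ => bar x.1 :: x.2) ?_ ?_ ?_
    · rintro ⟨a, u⟩ ⟨hl, h⟩
      exact ⟨by simpa using hl, h⟩
    · rintro ⟨a, u⟩ ⟨a', u'⟩ - - h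
      simp only [List.cons.injEq, bar_inj] at h
      rw [h.1, h.2]
    · rintro w ⟨hl, h⟩
      obtain ⟨a, u, rfl⟩ := exists_eq_cons (z := w) (by omega)
      exact ⟨(bar a, u), ⟨by simpa using hl, by simpa using h⟩, by simp⟩
  have hAB : {x : Fin 2 × List (Fin 2) | x.2.length = l + 1 ∧ IsFactor (x.2 ++ [x.1]) ∧
      IsFactor (bar x.1 :: x.2)}.ncard ≤ numDiff (l + 1 + 2) + (nonExtensions (l + 1)).ncard := by
    have hsub : {x : Fin 2 × List (Fin 2) | x.2.length = l + 1 ∧ IsFactor (x.2 ++ [x.1]) ∧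
        IsFactor (bar x.1 :: x.2)} ⊆
        {x | x.2.length = l + 1 ∧ IsFactor (bar x.1 :: (x.2 ++ [x.1]))} ∪
        {x | (bar x.1, x.1, x.2) ∈ nonExtensions (l + 1)} := by
      rintro ⟨a, u⟩ ⟨hl, h1, h2⟩
      by_cases h : IsFactor (bar a :: (u ++ [a]))
      · exact Or.inl ⟨hl, h⟩
      · exact Or.inr ⟨hl, h2, h1, h⟩
    refine (Set.ncard_le_ncard hsub ?_).trans ((Set.ncard_union_le _ _).trans (add_le_add ?_ ?_))
    · exact (Set.finite_univ.prod (List.finite_length_eq (Fin 2) (l + 1))).subset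
        fun x h => ⟨trivial, h.elim (fun h => h.1) fun h => h.1⟩
    · refine Set.ncard_le_ncard_of_injOn (fun x => bar x.1 :: (x.2 ++ [x.1])) ?_ ?_
        ((finite_factors _).subset fun _ h => h.1)
      · rintro ⟨a, u⟩ ⟨hl, h⟩
        refine ⟨⟨by simpa using hl, h⟩, ?_⟩
        rw [getLast?_cons_concat]
        simp
      · rintro ⟨a, v⟩ - ⟨a', v'⟩ - h
        simp only [List.cons.injEq, bar_inj] at h
        rw [h.1, (List.append_inj' h.2 rfl).1]
    · refine Set.ncard_le_ncard_of_injOn (fun x => (bar x.1, x.1, x.2)) (fun x h => h) ?_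
        (finite_nonExtensions _)
      rintro ⟨a, v⟩ - ⟨a', v'⟩ - h
      simp only [Prod.mk.injEq] at h ⊢
      exact h.2
  have hfin (P : Fin 2 × List (Fin 2) → Prop) :
      {x : Fin 2 × List (Fin 2) | x.2.length = l + 1 ∧ P x}.Finite :=
    (Set.finite_univ.prod (List.finite_length_eq (Fin 2) (l + 1))).subset
      fun x h => ⟨trivial, h.1⟩
  have hsum := Set.ncard_union_add_ncard_inter _ _
    (hfin fun x => IsFactor (x.2 ++ [x.1])) (hfin fun x => IsFactor (bar x.1 :: x.2))
  rw [hA, hB] at hsum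
  have h1 : {x : Fin 2 × List (Fin 2) | x.2.length = l + 1 ∧ IsFactor (x.2 ++ [x.1])} ∪
      {x | x.2.length = l + 1 ∧ IsFactor (bar x.1 :: x.2)} = readings (l + 1) := by
    ext x
    simp only [readings, Set.mem_union, Set.mem_ofPred_eq]
    tauto
  have h2 : {x : Fin 2 × List (Fin 2) | x.2.length = l + 1 ∧ IsFactor (x.2 ++ [x.1])} ∩
      {x | x.2.length = l + 1 ∧ IsFactor (bar x.1 :: x.2)} = {x | x.2.length = l + 1 ∧
        IsFactor (x.2 ++ [x.1]) ∧ IsFactor (bar x.1 :: x.2)} := by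
    ext x
    simp only [Set.mem_inter_iff, Set.mem_ofPred_eq]
    tauto
  rw [h1, h2] at hsum
  omega

/-! ### Recurrences and bounds for the factor counts. -/

/-- The number of factors of length `n + 1`, as an integer. -/
noncomputable def numAll (n : ℕ) : ℤ := numDiff (n + 1) + numSame (n + 1)

/-- The sum of the values `1` and `-1` over the factors of length `n + 1` whose first and last
letters differ, respectively agree. -/
noncomputable def corr (n : ℕ) : ℤ := numDiff (n + 1) - numSame (n + 1)

theorem numAll_two_mul {n : ℕ} (hn : 2 ≤ n) : numAll (2 * n) = 2 * numAll n := by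
  rw [numAll, numAll, numDiff_two_mul_add_one hn, numSame_two_mul_add_one hn]
  push_cast; ring

theorem corr_two_mul {n : ℕ} (hn : 2 ≤ n) : corr (2 * n) = 2 * corr n := by
  rw [corr, corr, numDiff_two_mul_add_one hn, numSame_two_mul_add_one hn]
  push_cast; ring

theorem numAll_two_mul_add_one {n : ℕ} (hn : 1 ≤ n) :
    numAll (2 * n + 1) = numAll n + numAll (n + 1) := by
  rw [numAll, numAll, numAll, show 2 * n + 1 + 1 = 2 * (n + 1) by ring,
    numDiff_two_mul (by omega), numSame_two_mul (by omega)]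
  push_cast; ring

theorem corr_two_mul_add_one {n : ℕ} (hn : 1 ≤ n) :
    corr (2 * n + 1) = -(corr n + corr (n + 1)) := by
  rw [corr, corr, corr, show 2 * n + 1 + 1 = 2 * (n + 1) by ring,
    numDiff_two_mul (by omega), numSame_two_mul (by omega)]
  push_cast; ring

/-- Sums of consecutive values of `corr`. -/
noncomputable def corrSum (n : ℕ) : ℤ := corr n + corr (n + 1)

/-- Differences of consecutive values of `corr`. -/
noncomputable def corrDiff (n : ℕ) : ℤ := corr n - corr (n + 1)

/-- The pair (`corrSum`, `corrDiff`) at `n` depends linearly on the pair at `n / 2` alone, whereas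
`corr` involves two neighbouring values. -/
theorem corrSum_even {n m : ℕ} (h : n = 2 * m) (hm : 2 ≤ m) : corrSum n = corrDiff m := by
  subst h
  rw [corrSum, corrDiff, corr_two_mul hm, corr_two_mul_add_one (by omega)]
  ring

theorem corrSum_odd {n m : ℕ} (h : n = 2 * m + 1) (hm : 2 ≤ m) : corrSum n = -corrDiff m := by
  subst h
  rw [corrSum, corrDiff, corr_two_mul_add_one (by omega), show 2 * m + 1 + 1 = 2 * (m + 1) by ring,
    corr_two_mul (by omega)]
  ring

theorem corrDiff_even {n m : ℕ} (h : n = 2 * m) (hm : 2 ≤ m) :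
    corrDiff n = corrDiff m + 2 * corrSum m := by
  subst h
  rw [corrSum, corrDiff, corrDiff, corr_two_mul hm, corr_two_mul_add_one (by omega)]
  ring

theorem corrDiff_odd {n m : ℕ} (h : n = 2 * m + 1) (hm : 2 ≤ m) :
    corrDiff n = corrDiff m - 2 * corrSum m := by
  subst h
  rw [corrSum, corrDiff, corrDiff, corr_two_mul_add_one (by omega),
    show 2 * m + 1 + 1 = 2 * (m + 1) by ring, corr_two_mul (by omega)]
  ring

theorem corr_one : corr 1 = 0 := by rw [corr, numDiff_two, numSame_two]; rfl

theorem corr_two : corr 2 = 2 := by rw [corr, numDiff_three, numSame_three]; rfl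

theorem corr_three : corr 3 = -2 := by
  rw [corr_two_mul_add_one (n := 1) le_rfl, corr_one, corr_two]; rfl

theorem corrSum_two : corrSum 2 = 0 := by rw [corrSum, corr_two, corr_three]; rfl

theorem corrDiff_two : corrDiff 2 = 4 := by rw [corrDiff, corr_two, corr_three]; rfl

theorem corrSum_three : corrSum 3 = 2 := by
  rw [corrSum, corr_two_mul (n := 2) le_rfl, corr_two, corr_three]; rfl

theorem corrDiff_three : corrDiff 3 = -6 := by
  rw [corrDiff, corr_two_mul (n := 2) le_rfl, corr_two, corr_three]; rfl

theorem corr_values : corrSum 4 = 4 ∧ corrDiff 4 = 4 ∧ corrSum 5 = -4 ∧ corrDiff 5 = 4 ∧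
    corrSum 6 = -6 ∧ corrDiff 6 = -2 ∧ corrSum 7 = 6 ∧ corrDiff 7 = -10 := by
  rw [corrSum_even (n := 4) (m := 2) rfl le_rfl, corrDiff_even (n := 4) (m := 2) rfl le_rfl,
    corrSum_odd (n := 5) (m := 2) rfl le_rfl, corrDiff_odd (n := 5) (m := 2) rfl le_rfl,
    corrSum_even (n := 6) (m := 3) rfl (by norm_num),
    corrDiff_even (n := 6) (m := 3) rfl (by norm_num),
    corrSum_odd (n := 7) (m := 3) rfl (by norm_num),
    corrDiff_odd (n := 7) (m := 3) rfl (by norm_num),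
    corrSum_two, corrDiff_two, corrSum_three, corrDiff_three]
  norm_num

theorem numAll_values : numAll 4 = 12 ∧ numAll 5 = 16 ∧ numAll 6 = 20 ∧ numAll 7 = 22 ∧
    numAll 8 = 24 := by
  have h1 : numAll 1 = 4 := by rw [numAll, numDiff_two, numSame_two]; rfl
  have h2 : numAll 2 = 6 := by rw [numAll, numDiff_three, numSame_three]; rfl
  have h3 := numAll_two_mul_add_one (n := 1) le_rfl
  have h4 := numAll_two_mul (n := 2) le_rfl
  have h5 := numAll_two_mul_add_one (n := 2) (by norm_num)
  have h6 := numAll_two_mul (n := 3) (by norm_num)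
  have h7 := numAll_two_mul_add_one (n := 3) (by norm_num)
  have h8 := numAll_two_mul (n := 4) (by norm_num)
  norm_num at h3 h4 h5 h6 h7 h8
  omega

/-- Both recurrences preserve linear interpolation. The ranges are closed at both ends so that `k`
and `k + 1` fall in the same one. -/
theorem numAll_eq (j : ℕ) : ∀ m : ℕ, (4 * 2 ^ j ≤ m → m ≤ 6 * 2 ^ j →
    numAll m = 4 * m - 4 * 2 ^ j) ∧
    (6 * 2 ^ j ≤ m → m ≤ 8 * 2 ^ j → numAll m = 2 * m + 8 * 2 ^ j) := by
  induction j with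
  | zero =>
    intro m
    obtain ⟨h4, h5, h6, h7, h8⟩ := numAll_values
    constructor <;> intro h h' <;> norm_num at h h' <;> interval_cases m <;> norm_num [*]
  | succ j ih =>
    intro m
    rw [pow_succ, pow_succ]
    have hP : 1 ≤ 2 ^ j := Nat.one_le_two_pow
    obtain ⟨k, rfl | rfl⟩ := Nat.even_or_odd' m
    · refine ⟨fun h h' => ?_, fun h h' => ?_⟩
      · rw [numAll_two_mul (by omega), (ih k).1 (by omega) (by omega)]
        push_cast; ring
      · rw [numAll_two_mul (by omega), (ih k).2 (by omega) (by omega)]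
        push_cast; ring
    · refine ⟨fun h h' => ?_, fun h h' => ?_⟩
      · rw [numAll_two_mul_add_one (by omega), (ih k).1 (by omega) (by omega),
          (ih (k + 1)).1 (by omega) (by omega)]
        push_cast; ring
      · rw [numAll_two_mul_add_one (by omega), (ih k).2 (by omega) (by omega),
          (ih (k + 1)).2 (by omega) (by omega)]
        push_cast; ring

/-- In absolute values the recursion is dominated by (s, d) ↦ (d, d + 2s), with eigenvalues 2 and
-1; hence the terms `2 ^ j` and `(-1) ^ j`. -/
theorem corr_bounds_lower_half (j : ℕ) : ∀ m : ℕ, 4 * 2 ^ j ≤ m → m < 6 * 2 ^ j →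
    3 * |corrSum m| ≤ 8 * 2 ^ j + 4 * (-1) ^ j ∧ 3 * |corrDiff m| ≤ 16 * 2 ^ j - 4 * (-1) ^ j := by
  induction j with
  | zero =>
    intro m h h'
    obtain ⟨h1, h2, h3, h4, -⟩ := corr_values
    norm_num at h h'
    interval_cases m <;> norm_num [*]
  | succ j ih =>
    intro m h h'
    rw [pow_succ] at h h'
    rw [pow_succ, pow_succ]
    have hP : 1 ≤ 2 ^ j := Nat.one_le_two_pow
    obtain ⟨k, hk | hk⟩ := Nat.even_or_odd' m
    · obtain ⟨h1, h2⟩ := ih k (by omega) (by omega)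
      rw [corrSum_even hk (by omega), corrDiff_even hk (by omega)]
      have := abs_add_le (corrDiff k) (2 * corrSum k)
      rw [abs_mul, abs_two] at this
      constructor <;> linarith
    · obtain ⟨h1, h2⟩ := ih k (by omega) (by omega)
      rw [corrSum_odd hk (by omega), corrDiff_odd hk (by omega), abs_neg]
      have := abs_sub (corrDiff k) (2 * corrSum k)
      rw [abs_mul, abs_two] at this
      constructor <;> linarith

theorem corr_bounds_upper_half (j : ℕ) : ∀ m : ℕ, 6 * 2 ^ j ≤ m → m < 8 * 2 ^ j →
    3 * |corrSum m| ≤ 16 * 2 ^ j + 2 * (-1) ^ j ∧ 3 * |corrDiff m| ≤ 32 * 2 ^ j - 2 * (-1) ^ j := by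
  induction j with
  | zero =>
    intro m h h'
    obtain ⟨-, -, -, -, h1, h2, h3, h4⟩ := corr_values
    norm_num at h h'
    interval_cases m <;> norm_num [*]
  | succ j ih =>
    intro m h h'
    rw [pow_succ] at h h'
    rw [pow_succ, pow_succ]
    have hP : 1 ≤ 2 ^ j := Nat.one_le_two_pow
    obtain ⟨k, hk | hk⟩ := Nat.even_or_odd' m
    · obtain ⟨h1, h2⟩ := ih k (by omega) (by omega)
      rw [corrSum_even hk (by omega), corrDiff_even hk (by omega)]
      have := abs_add_le (corrDiff k) (2 * corrSum k)
      rw [abs_mul, abs_two] at this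
      constructor <;> linarith
    · obtain ⟨h1, h2⟩ := ih k (by omega) (by omega)
      rw [corrSum_odd hk (by omega), corrDiff_odd hk (by omega), abs_neg]
      have := abs_sub (corrDiff k) (2 * corrSum k)
      rw [abs_mul, abs_two] at this
      constructor <;> linarith

/-- At these points, and at `4 * 2 ^ i - 1` below, the signs always add up, so the bounds on
`corrSum` are attained at the outer ends of the dyadic interval. -/
theorem corr_two_pow (i : ℕ) : 3 * corrSum (2 * 2 ^ i) = 4 * 2 ^ i - 4 * (-1) ^ i ∧
    3 * corrDiff (2 * 2 ^ i) = 8 * 2 ^ i + 4 * (-1) ^ i := by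
  induction i with
  | zero => norm_num [corrSum_two, corrDiff_two]
  | succ i ih =>
    have hP : 1 ≤ 2 ^ i := Nat.one_le_two_pow
    have h : 2 * 2 ^ (i + 1) = 2 * (2 * 2 ^ i) := by ring
    rw [corrSum_even h (by omega), corrDiff_even h (by omega), pow_succ, pow_succ]
    constructor <;> linarith

theorem corr_two_pow_sub_one (i : ℕ) : 3 * corrSum (4 * 2 ^ i - 1) = 8 * 2 ^ i - 2 * (-1) ^ i ∧
    3 * corrDiff (4 * 2 ^ i - 1) = -(16 * 2 ^ i + 2 * (-1) ^ i) := by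
  induction i with
  | zero => norm_num [corrSum_three, corrDiff_three]
  | succ i ih =>
    have hP : 1 ≤ 2 ^ i := Nat.one_le_two_pow
    have h : 4 * 2 ^ (i + 1) - 1 = 2 * (4 * 2 ^ i - 1) + 1 := by rw [pow_succ]; omega
    rw [corrSum_odd h (by omega), corrDiff_odd h (by omega), pow_succ, pow_succ]
    constructor <;> linarith

theorem corr_three_mul_two_pow_nonpos (j : ℕ) :
    corrSum (6 * 2 ^ j) ≤ 0 ∧ corrDiff (6 * 2 ^ j) ≤ 0 := by
  induction j with
  | zero =>
    obtain ⟨-, -, -, -, h1, h2, -⟩ := corr_values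
    norm_num [h1, h2]
  | succ j ih =>
    have hP : 1 ≤ 2 ^ j := Nat.one_le_two_pow
    have h : 6 * 2 ^ (j + 1) = 2 * (6 * 2 ^ j) := by ring
    rw [corrSum_even h (by omega), corrDiff_even h (by omega)]
    constructor <;> linarith

/-- Near the left end the uniform bound is too weak for (iii). The right side is exactly what
`complexity_lower_half` needs at `m = 16 * 2 ^ i + r`. -/
theorem corrSum_two_pow_add_le (i r : ℕ) (hi : 1 ≤ i) (hr1 : 1 ≤ r) (hr : r ≤ 6) :
    3 * corrSum (16 * 2 ^ i + r) ≤ 32 * 2 ^ i + 8 * r - 52 := by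
  obtain ⟨h1, h2⟩ := corr_two_pow i
  have hP : 2 ≤ 2 ^ i := le_self_pow₀ one_le_two (by omega)
  have hP' : (2 : ℤ) ≤ 2 ^ i := by exact_mod_cast hP
  have hM : 16 * 2 ^ i = 8 * (2 * 2 ^ i) := by ring
  rw [hM]
  generalize 2 * 2 ^ i = M at *
  -- Three binary digits are appended to `M`, where the values are known exactly.
  have corrSum2_0 := corrSum_even (n := 2 * M) (m := M) (by omega) (by omega)
  have corrDiff2_0 := corrDiff_even (n := 2 * M) (m := M) (by omega) (by omega)
  have corrSum2_1 := corrSum_odd (n := 2 * M + 1) (m := M) (by omega) (by omega)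
  have corrDiff2_1 := corrDiff_odd (n := 2 * M + 1) (m := M) (by omega) (by omega)
  have corrSum4_0 := corrSum_even (n := 4 * M) (m := 2 * M) (by omega) (by omega)
  have corrDiff4_0 := corrDiff_even (n := 4 * M) (m := 2 * M) (by omega) (by omega)
  have corrSum4_1 := corrSum_odd (n := 4 * M + 1) (m := 2 * M) (by omega) (by omega)
  have corrDiff4_1 := corrDiff_odd (n := 4 * M + 1) (m := 2 * M) (by omega) (by omega)
  have corrSum4_2 := corrSum_even (n := 4 * M + 2) (m := 2 * M + 1) (by omega) (by omega)
  have corrDiff4_2 := corrDiff_even (n := 4 * M + 2) (m := 2 * M + 1) (by omega) (by omega)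
  have corrSum4_3 := corrSum_odd (n := 4 * M + 3) (m := 2 * M + 1) (by omega) (by omega)
  have corrDiff4_3 := corrDiff_odd (n := 4 * M + 3) (m := 2 * M + 1) (by omega) (by omega)
  have corrSum8_1 := corrSum_odd (n := 8 * M + 1) (m := 4 * M) (by omega) (by omega)
  have corrSum8_2 := corrSum_even (n := 8 * M + 2) (m := 4 * M + 1) (by omega) (by omega)
  have corrSum8_3 := corrSum_odd (n := 8 * M + 3) (m := 4 * M + 1) (by omega) (by omega)
  have corrSum8_4 := corrSum_even (n := 8 * M + 4) (m := 4 * M + 2) (by omega) (by omega)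
  have corrSum8_5 := corrSum_odd (n := 8 * M + 5) (m := 4 * M + 2) (by omega) (by omega)
  have corrSum8_6 := corrSum_even (n := 8 * M + 6) (m := 4 * M + 3) (by omega) (by omega)
  rcases neg_one_pow_eq_or ℤ i with he | he <;> rw [he] at h1 h2 <;> interval_cases r <;>
    push_cast <;> linarith

/-- The counterpart near the right end, matched to `complexity_upper_half`; here four binary digits
are appended to `4 * 2 ^ i - 1`. -/
theorem corrSum_two_pow_sub_le (i r : ℕ) (hr1 : 2 ≤ r) (hr : r ≤ 11) :
    3 * corrSum (64 * 2 ^ i - r) ≤ 128 * 2 ^ i + 4 * r - 46 := by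
  obtain ⟨h1, h2⟩ := corr_two_pow_sub_one i
  have hP : 1 ≤ 2 ^ i := Nat.one_le_two_pow
  have hP' : (1 : ℤ) ≤ 2 ^ i := by exact_mod_cast hP
  obtain ⟨t, ht, rfl⟩ : ∃ t, t ≤ 14 ∧ r = 16 - t := ⟨16 - r, by omega, by omega⟩
  have hM : 64 * 2 ^ i - (16 - t) = 16 * (4 * 2 ^ i - 1) + t := by omega
  have hM2 : 2 ≤ 4 * 2 ^ i - 1 := by omega
  rw [hM]
  generalize 4 * 2 ^ i - 1 = M at *
  have corrSum2_0 := corrSum_even (n := 2 * M) (m := M) (by omega) (by omega)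
  have corrDiff2_0 := corrDiff_even (n := 2 * M) (m := M) (by omega) (by omega)
  have corrSum2_1 := corrSum_odd (n := 2 * M + 1) (m := M) (by omega) (by omega)
  have corrDiff2_1 := corrDiff_odd (n := 2 * M + 1) (m := M) (by omega) (by omega)
  have corrSum4_1 := corrSum_odd (n := 4 * M + 1) (m := 2 * M) (by omega) (by omega)
  have corrDiff4_1 := corrDiff_odd (n := 4 * M + 1) (m := 2 * M) (by omega) (by omega)
  have corrSum4_2 := corrSum_even (n := 4 * M + 2) (m := 2 * M + 1) (by omega) (by omega)
  have corrDiff4_2 := corrDiff_even (n := 4 * M + 2) (m := 2 * M + 1) (by omega) (by omega)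
  have corrSum4_3 := corrSum_odd (n := 4 * M + 3) (m := 2 * M + 1) (by omega) (by omega)
  have corrDiff4_3 := corrDiff_odd (n := 4 * M + 3) (m := 2 * M + 1) (by omega) (by omega)
  have corrDiff8_2 := corrDiff_even (n := 8 * M + 2) (m := 4 * M + 1) (by omega) (by omega)
  have corrDiff8_3 := corrDiff_odd (n := 8 * M + 3) (m := 4 * M + 1) (by omega) (by omega)
  have corrDiff8_4 := corrDiff_even (n := 8 * M + 4) (m := 4 * M + 2) (by omega) (by omega)
  have corrDiff8_5 := corrDiff_odd (n := 8 * M + 5) (m := 4 * M + 2) (by omega) (by omega)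
  have corrDiff8_6 := corrDiff_even (n := 8 * M + 6) (m := 4 * M + 3) (by omega) (by omega)
  have corrDiff8_7 := corrDiff_odd (n := 8 * M + 7) (m := 4 * M + 3) (by omega) (by omega)
  have corrSum16_5 := corrSum_odd (n := 16 * M + 5) (m := 8 * M + 2) (by omega) (by omega)
  have corrSum16_6 := corrSum_even (n := 16 * M + 6) (m := 8 * M + 3) (by omega) (by omega)
  have corrSum16_7 := corrSum_odd (n := 16 * M + 7) (m := 8 * M + 3) (by omega) (by omega)
  have corrSum16_8 := corrSum_even (n := 16 * M + 8) (m := 8 * M + 4) (by omega) (by omega)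
  have corrSum16_9 := corrSum_odd (n := 16 * M + 9) (m := 8 * M + 4) (by omega) (by omega)
  have corrSum16_10 := corrSum_even (n := 16 * M + 10) (m := 8 * M + 5) (by omega) (by omega)
  have corrSum16_11 := corrSum_odd (n := 16 * M + 11) (m := 8 * M + 5) (by omega) (by omega)
  have corrSum16_12 := corrSum_even (n := 16 * M + 12) (m := 8 * M + 6) (by omega) (by omega)
  have corrSum16_13 := corrSum_odd (n := 16 * M + 13) (m := 8 * M + 6) (by omega) (by omega)
  have corrSum16_14 := corrSum_even (n := 16 * M + 14) (m := 8 * M + 7) (by omega) (by omega)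
  have ht5 : 5 ≤ t := by omega
  rw [Nat.cast_sub (by omega)]
  clear hM hr1 hr
  rcases neg_one_pow_eq_or ℤ i with he | he <;> rw [he] at h1 h2 <;> interval_cases t <;>
    push_cast <;> linarith

/-! ### Lower bounds at odd lengths. -/

/-- The complexity at odd numbers in the lower half of a dyadic interval. -/
theorem complexity_lower_half {j m : ℕ} (hm : 6 ≤ m) (h1 : 4 * 2 ^ j ≤ m) (h2 : m < 6 * 2 ^ j) :
    24 * (m : ℤ) - 24 * 2 ^ j - 12 - 3 * corrSum m ≤
      6 * cyclicComplexity thueMorse (2 * m + 1) := by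
  have h := two_mul_add_one_complexity hm
  rw [ncard_factors] at h
  have h0 : nonExtensions m = ∅ := by
    by_contra hne
    obtain ⟨i, rfl⟩ := exists_eq_of_nonExtensions_ne_empty m (by omega) hne
    have hi : i < j + 1 := by
      rw [← Nat.pow_lt_pow_iff_right (a := 2) (by norm_num), pow_succ]; omega
    have := Nat.pow_le_pow_right (n := 2) (by norm_num) (Nat.lt_succ_iff.1 hi)
    omega
  rw [h0, Set.ncard_empty] at h
  have h3 := (numAll_eq j m).1 h1 h2.le
  have h4 := (numAll_eq j (m + 1)).1 (by omega) (by omega)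
  have h5 : corrSum m = corr m + corr (m + 1) := rfl
  unfold numAll at h3 h4
  unfold corr at h5
  push_cast at h3 h4 h5
  zify at h
  linarith

/-- The complexity at odd numbers in the upper half of a dyadic interval. -/
theorem complexity_upper_half {j m : ℕ} (hm : 6 ≤ m) (h1 : 6 * 2 ^ j < m) (h2 : m < 8 * 2 ^ j) :
    12 * (m : ℤ) + 48 * 2 ^ j - 6 - 3 * corrSum m ≤
      6 * cyclicComplexity thueMorse (2 * m + 1) := by
  have h := two_mul_add_one_complexity hm
  rw [ncard_factors] at h
  have h0 : nonExtensions m = ∅ := by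
    by_contra hne
    obtain ⟨i, rfl⟩ := exists_eq_of_nonExtensions_ne_empty m (by omega) hne
    have hi : i < j + 2 := by
      rw [← Nat.pow_lt_pow_iff_right (a := 2) (by norm_num), pow_add]; omega
    have := Nat.pow_le_pow_right (n := 2) (by norm_num) (Nat.lt_succ_iff.1 hi)
    rw [pow_succ] at this
    omega
  rw [h0, Set.ncard_empty] at h
  have h3 := (numAll_eq j m).2 h1.le h2.le
  have h4 := (numAll_eq j (m + 1)).2 (by omega) (by omega)
  have h5 : corrSum m = corr m + corr (m + 1) := rfl
  unfold numAll at h3 h4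
  unfold corr at h5
  push_cast at h3 h4 h5
  zify at h
  linarith

/-- Here `m = 3 * 2 ^ (j + 1)`, and 24 of the 30 pays for four possible non-extensions. -/
theorem complexity_middle (j : ℕ) :
    120 * 2 ^ j - 30 - 3 * corrSum (6 * 2 ^ j) ≤
      6 * (cyclicComplexity thueMorse (2 * (6 * 2 ^ j) + 1) : ℤ) := by
  have hP : 1 ≤ 2 ^ j := Nat.one_le_two_pow
  have h := two_mul_add_one_complexity (m := 6 * 2 ^ j) (by omega)
  rw [ncard_factors] at h
  have h0 := ncard_nonExtensions_le (6 * 2 ^ j) (by omega)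
  have h3 := (numAll_eq j (6 * 2 ^ j)).2 le_rfl (by omega)
  have h4 := (numAll_eq j (6 * 2 ^ j + 1)).2 (by omega) (by omega)
  have h5 : corrSum (6 * 2 ^ j) = corr (6 * 2 ^ j) + corr (6 * 2 ^ j + 1) := rfl
  unfold numAll at h3 h4
  unfold corr at h5
  push_cast at h3 h4 h5
  zify at h h0
  linarith

theorem exists_dyadic {m : ℕ} (hm : 4 ≤ m) : ∃ j, 4 * 2 ^ j ≤ m ∧ m < 8 * 2 ^ j := by
  refine ⟨Nat.log 2 m - 2, ?_⟩
  have h1 := Nat.pow_log_le_self 2 (x := m) (by omega)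
  have h2 := Nat.lt_pow_succ_log_self (b := 2) (by norm_num) m
  have h3 : 2 ≤ Nat.log 2 m := by
    exact Nat.le_log_of_pow_le (by norm_num) hm
  obtain ⟨j, hj⟩ := Nat.exists_eq_add_of_le' h3
  rw [hj] at h1 h2 ⊢
  rw [pow_succ, pow_add] at h2
  rw [pow_add] at h1
  simp only [Nat.add_sub_cancel]
  omega

/-- The general lower bound at odd numbers. -/
theorem complexity_odd_lower_bound {m : ℕ} (hm : 6 ≤ m) :
    4 * (2 * (m : ℤ) + 1) - 12 ≤ 3 * cyclicComplexity thueMorse (2 * m + 1) := by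
  obtain ⟨j, h1, h2⟩ := exists_dyadic (m := m) (by omega)
  have hP : 1 ≤ 2 ^ j := Nat.one_le_two_pow
  have hP' : (1 : ℤ) ≤ 2 ^ j := by exact_mod_cast hP
  have he := neg_one_pow_eq_or ℤ j
  rcases lt_trichotomy m (6 * 2 ^ j) with h | h | h
  · have hc := complexity_lower_half hm h1 h
    have hb := (corr_bounds_lower_half j m h1 h).1
    have hs := le_abs_self (corrSum m)
    zify at h1
    -- There is no slack at `m = 4 * 2 ^ j` with `j` even.
    rcases he with he | he <;> rw [he] at hb <;> linarith
  · subst h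
    have hc := complexity_middle j
    have hs := (corr_three_mul_two_pow_nonpos j).1
    push_cast
    linarith
  · have hc := complexity_upper_half hm h h2
    have hb := (corr_bounds_upper_half j m h.le h2).1
    have hs := le_abs_self (corrSum m)
    zify at h2
    rcases he with he | he <;> rw [he] at hb <;> omega

/-! ### The increment under doubling. -/

theorem numDiff_eq {m : ℕ} (hm : 1 ≤ m) :
    2 * (numDiff (2 * m + 2) : ℤ) = numAll m + numAll (m + 1) - corrSum m := by
  have h := numDiff_two_mul (m := m + 1) (by omega)
  rw [mul_add, mul_one] at h
  rw [h, corrSum, corr, corr, numAll, numAll]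
  push_cast; ring

/-- The increments of the complexity under doubling of an odd number. -/
theorem numDiff_lower_half {j m : ℕ} (h1 : 4 * 2 ^ j ≤ m) (h2 : m < 6 * 2 ^ j) :
    24 * (m : ℤ) - 24 * 2 ^ j + 12 - 3 * corrSum m = 6 * numDiff (2 * m + 2) := by
  have hP : 1 ≤ 2 ^ j := Nat.one_le_two_pow
  have h := numDiff_eq (m := m) (by omega)
  rw [(numAll_eq j m).1 h1 h2.le, (numAll_eq j (m + 1)).1 (by omega) (by omega)] at h
  push_cast at h
  linarith

theorem numDiff_upper_half {j m : ℕ} (h1 : 6 * 2 ^ j ≤ m) (h2 : m < 8 * 2 ^ j) :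
    12 * (m : ℤ) + 48 * 2 ^ j + 6 - 3 * corrSum m = 6 * numDiff (2 * m + 2) := by
  have hP : 1 ≤ 2 ^ j := Nat.one_le_two_pow
  have h := numDiff_eq (m := m) (by omega)
  rw [(numAll_eq j m).2 h1 h2.le, (numAll_eq j (m + 1)).2 (by omega) (by omega)] at h
  push_cast at h
  linarith

theorem numDiff_odd_lower_bound {m : ℕ} (hm : 4 ≤ m) :
    4 * (2 * (m : ℤ) + 1) ≤ 3 * numDiff (2 * m + 2) := by
  obtain ⟨j, h1, h2⟩ := exists_dyadic (m := m) (by omega)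
  have hP : 1 ≤ 2 ^ j := Nat.one_le_two_pow
  have hP' : (1 : ℤ) ≤ 2 ^ j := by exact_mod_cast hP
  have he := neg_one_pow_eq_or ℤ j
  have hs := le_abs_self (corrSum m)
  rcases lt_or_ge m (6 * 2 ^ j) with h | h
  · have hc := numDiff_lower_half h1 h
    have hb := (corr_bounds_lower_half j m h1 h).1
    zify at h1
    rcases he with he | he <;> rw [he] at hb <;> linarith
  · have hc := numDiff_upper_half h h2
    have hb := (corr_bounds_upper_half j m h h2).1
    zify at h2
    rcases he with he | he <;> rw [he] at hb <;> omega

/-- The factors of length `n + 1` with distinct first and last letters are at least `4 n / 3`. -/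
theorem numDiff_lower_bound {n : ℕ} (hn : 3 ≤ n) : 4 * (n : ℤ) ≤ 3 * numDiff (n + 1) := by
  induction n using Nat.strong_induction_on with
  | _ n ih =>
    obtain ⟨k, rfl | rfl⟩ := Nat.even_or_odd' n
    · rw [numDiff_two_mul_add_one (by omega)]
      rcases Nat.lt_or_ge k 3 with hk | hk
      · obtain rfl : k = 2 := by omega
        rw [numDiff_three]; norm_num
      · have := ih k (by omega) hk
        push_cast
        linarith
    · rcases Nat.lt_or_ge k 4 with hk | hk
      · have h4 := numDiff_two_mul (m := 2) le_rfl
        have h6 := numDiff_two_mul (m := 3) (by norm_num)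
        have h8 := numDiff_two_mul (m := 4) (by norm_num)
        have h4' := numSame_two_mul (m := 2) le_rfl
        have h5' := numSame_two_mul_add_one (m := 2) le_rfl
        norm_num [numDiff_two, numDiff_three, numSame_two, numSame_three] at h4 h4' h5' h6 h8
        rw [h4'] at h6
        rw [h4', h5'] at h8
        have hk1 : 1 ≤ k := by omega
        interval_cases k <;> norm_num [*]
      · exact_mod_cast numDiff_odd_lower_bound hk

/-- The start of each doubling chain in (ii): the estimates for an odd length and for its increment
are added before bounding, as their sum loses less. -/
theorem double_complexity_odd_lower_bound {m : ℕ} (hm : 6 ≤ m) (hJ : 2 * m + 1 ∉ setJ) :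
    4 * (2 * (2 * (m : ℤ) + 1)) - 6 ≤
      3 * cyclicComplexity thueMorse (2 * m + 1) + 3 * numDiff (2 * m + 2) := by
  obtain ⟨j, h1, h2⟩ := exists_dyadic (m := m) (by omega)
  have hP : 1 ≤ 2 ^ j := Nat.one_le_two_pow
  have hP' : (1 : ℤ) ≤ 2 ^ j := by exact_mod_cast hP
  have he := neg_one_pow_eq_or ℤ j
  rcases lt_trichotomy m (6 * 2 ^ j) with h | h | h
  · have hc := complexity_lower_half hm h1 h
    have hd := numDiff_lower_half h1 h
    have hb := (corr_bounds_lower_half j m h1 h).1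
    have hs := le_abs_self (corrSum m)
    rcases h1.eq_or_lt with h1 | h1
    · have he : (-1 : ℤ) ^ j = -1 := by
        rw [Odd.neg_one_pow]
        rw [← Nat.not_even_iff_odd]
        rintro ⟨i, rfl⟩
        refine hJ ⟨i + 1, 0, by omega, ?_⟩
        rw [← h1, ← two_mul]
        ring
      zify at h1
      rw [he] at hb
      linarith
    · zify at h1
      rcases he with he | he <;> rw [he] at hb <;> omega
  · have hd := numDiff_odd_lower_bound (m := m) (by omega)
    subst h
    have hc := complexity_middle j
    have hs := (corr_three_mul_two_pow_nonpos j).1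
    -- At `m = 6` the sign of `corrSum` is not enough for the linear estimate; its exact value is
    -- used.
    rcases j with _ | j
    · have h6 := corr_values.2.2.2.2.1
      norm_num at *
      linarith
    · have hP2 : (1 : ℤ) ≤ 2 ^ j := by exact_mod_cast Nat.one_le_two_pow
      push_cast [pow_succ] at *
      linarith
  · have hd := numDiff_odd_lower_bound (m := m) (by omega)
    have hc := complexity_upper_half hm h h2
    have hb := (corr_bounds_upper_half j m h.le h2).1
    have hs := le_abs_self (corrSum m)
    zify at h2
    rcases he with he | he <;> rw [he] at hb <;> omega

/-! ### Odd lengths away from powers of two. -/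

theorem corrSum_le_of_lt_thirtyOne {m : ℕ} (h1 : 24 < m) (h2 : m < 31) :
    3 * corrSum m + 4 * m ≤ 146 := by
  obtain ⟨-, -, -, -, h3, h4, h5, h6⟩ := corr_values
  have h12 := corrDiff_even (n := 12) (m := 6) rfl (by norm_num)
  have h13 := corrDiff_odd (n := 13) (m := 6) rfl (by norm_num)
  have h14 := corrDiff_even (n := 14) (m := 7) rfl (by norm_num)
  have h15 := corrDiff_odd (n := 15) (m := 7) rfl (by norm_num)
  have h25 := corrSum_odd (n := 25) (m := 12) rfl (by norm_num)
  have h26 := corrSum_even (n := 26) (m := 13) rfl (by norm_num)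
  have h27 := corrSum_odd (n := 27) (m := 13) rfl (by norm_num)
  have h28 := corrSum_even (n := 28) (m := 14) rfl (by norm_num)
  have h29 := corrSum_odd (n := 29) (m := 14) rfl (by norm_num)
  have h30 := corrSum_even (n := 30) (m := 15) rfl (by norm_num)
  interval_cases m <;> push_cast <;> omega

/-- The lower bound at odd numbers away from the exceptional powers of two. -/
theorem complexity_odd_lower_bound_of_notMem {m : ℕ} (hm : 23 ≤ m)
    (hAB : 2 * m + 1 ∉ setA ∪ setB) :
    4 * (2 * (m : ℤ) + 1) + 16 ≤ 3 * cyclicComplexity thueMorse (2 * m + 1) := by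
  obtain ⟨j, h1, h2⟩ := exists_dyadic (m := m) (by omega)
  have hj : 2 ≤ j := by
    by_contra! hj
    have := Nat.pow_le_pow_right (n := 2) (by norm_num) (Nat.lt_succ_iff.1 hj)
    omega
  obtain ⟨i, rfl⟩ := Nat.exists_eq_add_of_le' hj
  have he := neg_one_pow_eq_or ℤ (i + 2)
  have hP : 1 ≤ 2 ^ i := Nat.one_le_two_pow
  have hP' : (1 : ℤ) ≤ 2 ^ i := by exact_mod_cast hP
  have hpow : 2 ^ (i + 2) = 4 * 2 ^ i := by ring
  have hpow' : (2 : ℤ) ^ (i + 2) = 4 * 2 ^ i := by ring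
  have hs := le_abs_self (corrSum m)
  rcases lt_trichotomy m (6 * 2 ^ (i + 2)) with h | h | h
  · have hc := complexity_lower_half (by omega) h1 h
    have hb := (corr_bounds_lower_half (i + 2) m h1 h).1
    rw [hpow] at h1 h2 h
    rw [hpow'] at hc hb
    obtain ⟨r, rfl⟩ := Nat.exists_eq_add_of_le h1
    -- With the uniform bound the claim reduces to `8 * r ≥ 56` in the worst case; `r = 0` is the
    -- set B.
    rcases Nat.lt_or_ge r 7 with hr | hr
    · rcases Nat.eq_zero_or_pos r with rfl | hr0
      · exact absurd (Or.inr ⟨i + 5, by omega, by ring⟩) hAB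
      · have hi : 1 ≤ i := by
          by_contra! hi
          obtain rfl : i = 0 := by omega
          omega
        rw [show 4 * (4 * 2 ^ i) = 16 * 2 ^ i by ring] at *
        have := corrSum_two_pow_add_le i r hi hr0 (by omega)
        push_cast at *
        linarith
    · zify at hr
      push_cast at *
      rcases he with he | he <;> rw [he] at hb <;> linarith
  · subst h
    have hc := complexity_middle (i + 2)
    have hs := (corr_three_mul_two_pow_nonpos (i + 2)).1
    push_cast
    rw [hpow'] at *
    linarith
  · have hc := complexity_upper_half (by omega) h h2
    have hb := (corr_bounds_upper_half (i + 2) m h.le h2).1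
    rw [hpow] at h1 h2 h
    rw [hpow'] at hc hb
    obtain ⟨r, hr⟩ : ∃ r, r + m = 32 * 2 ^ i := ⟨32 * 2 ^ i - m, by omega⟩
    -- With the uniform bound the claim reduces to `4 * r ≥ 48` in the worst case; `r = 1` is the
    -- set A.
    rcases Nat.lt_or_ge r 12 with hr' | hr'
    · rcases Nat.lt_or_ge r 2 with hr2 | hr2
      · exact absurd (Or.inl ⟨i + 6, by omega, by rw [pow_add]; omega⟩) hAB
      · rcases i with _ | i
        · norm_num at *
          have := corrSum_le_of_lt_thirtyOne h (by omega)
          omega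
        · have hb' := corrSum_two_pow_sub_le i r hr2 (by omega)
          rw [pow_succ] at hr hc h2
          rw [show 64 * 2 ^ i - r = m by omega] at hb'
          have : (1 : ℤ) ≤ 2 ^ i := by exact_mod_cast Nat.one_le_two_pow
          zify at hr hr'
          linarith
    · zify at hr hr'
      rcases he with he | he <;> rw [he] at hb <;> linarith

/-! ### Small lengths and the induction by doubling. -/

/-- The classes of the factors of length `n` of the prefix of length 64. -/
def prefixClasses (n : ℕ) : Finset (Cycle (Fin 2)) :=
  ((List.range (65 - n)).map fun i =>
    ((((mu prefix32).drop i).take n : List (Fin 2)) : Cycle (Fin 2))).toFinset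

theorem card_prefixClasses_le {n : ℕ} (hn : n ≤ 64) :
    (prefixClasses n).card ≤ cyclicComplexity thueMorse n := by
  rw [cyclicComplexity, ← Set.ncard_coe_finset]
  refine Set.ncard_le_ncard ?_ (cyclicFactors_finite _ _)
  intro c hc
  rw [Finset.mem_coe, prefixClasses, List.mem_toFinset, List.mem_map] at hc
  obtain ⟨i, hi, rfl⟩ := hc
  rw [List.mem_range] at hi
  rw [cyclicFactors_eq_image]
  have hlen : (mu prefix32).length = 64 := rfl
  refine ⟨_, ⟨?_, (isFactor_of_infix_prefix32 List.infix_rfl).mu.of_infix ?_⟩, rfl⟩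
  · rw [List.length_take, List.length_drop, hlen]
    omega
  · exact (List.take_prefix _ _).isInfix.trans (List.drop_suffix _ _).isInfix

theorem card_prefixClasses : ∀ n < 12, 4 * n ≤ 3 * (prefixClasses n).card + 12 ∧
    (Even n → 4 * n ≤ 3 * (prefixClasses n).card + 6) := by decide +kernel

theorem card_prefixClasses_seven : 8 ≤ (prefixClasses 7).card := by decide +kernel

theorem card_prefixClasses_eleven : 13 ≤ (prefixClasses 11).card := by decide +kernel

theorem complexity_lower_bound (n : ℕ) : 4 * n ≤ 3 * cyclicComplexity thueMorse n + 12 := by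
  induction n using Nat.strong_induction_on with
  | _ n ih =>
    rcases Nat.lt_or_ge n 12 with hn | hn
    · have h1 := (card_prefixClasses n hn).1
      have h2 := card_prefixClasses_le (n := n) (by omega)
      omega
    · obtain ⟨m, rfl | rfl⟩ := Nat.even_or_odd' n
      · have h1 := two_mul_complexity (m := m) (by omega)
        have h2 := numDiff_lower_bound (n := m) (by omega)
        have h3 := ih m (by omega)
        omega
      · have h1 := complexity_odd_lower_bound (m := m) (by omega)
        omega

theorem two_mul_mem_setJ {m : ℕ} (h : m ∈ setJ) : 2 * m ∈ setJ := by
  obtain ⟨i, j, hi, rfl⟩ := h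
  exact ⟨i, j + 1, hi, by ring⟩

theorem complexity_even_lower_bound (n : ℕ) (hn : Even n) (hJ : n ∉ setJ) :
    4 * n ≤ 3 * cyclicComplexity thueMorse n + 6 := by
  induction n using Nat.strong_induction_on with
  | _ n ih =>
    rcases Nat.lt_or_ge n 12 with hn' | hn'
    · have h1 := (card_prefixClasses n hn').2 hn
      have h2 := card_prefixClasses_le (n := n) (by omega)
      omega
    obtain ⟨m, rfl⟩ := hn.two_dvd
    have hmJ : m ∉ setJ := fun h => hJ (two_mul_mem_setJ h)
    have h1 := two_mul_complexity (m := m) (by omega)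
    have h2 := numDiff_lower_bound (n := m) (by omega)
    obtain ⟨k, rfl | rfl⟩ := Nat.even_or_odd' m
    · have h3 := ih (2 * k) (by omega) (even_two_mul k) hmJ
      omega
    rcases Nat.lt_or_ge k 6 with hk | hk
    -- The odd halves are 7, 9 and 11, and `9 = 2 ^ 3 + 1` lies in J.
    · obtain rfl | rfl | rfl : k = 3 ∨ k = 4 ∨ k = 5 := by omega
      · have h3 := card_prefixClasses_seven
        have h4 := card_prefixClasses_le (n := 7) (by norm_num)
        norm_num at *
        omega
      · exact absurd ⟨1, 0, le_rfl, rfl⟩ hmJ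
      · have h3 := card_prefixClasses_eleven
        have h4 := card_prefixClasses_le (n := 11) (by norm_num)
        norm_num at *
        omega
    · have h3 := double_complexity_odd_lower_bound hk hmJ
      rw [show 2 * k + 1 + 1 = 2 * k + 2 by ring] at h1
      omega

end ThueMorse

theorem theorem5 :
    (∀ n : ℕ, (4 / 3 : ℝ) * (n : ℝ) - 4 ≤ (cyclicComplexity thueMorse n : ℝ)) ∧
    (∀ n : ℕ, Even n → n ∉ setJ →
      (4 / 3 : ℝ) * (n : ℝ) - 2 ≤ (cyclicComplexity thueMorse n : ℝ)) ∧
    (∀ n : ℕ, Odd n → 47 ≤ n → n ∉ setA ∪ setB →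
      (4 * (n : ℝ) + 16) / 3 ≤ (cyclicComplexity thueMorse n : ℝ)) := by
  refine ⟨fun n => ?_, fun n hn hJ => ?_, fun n hn h47 hAB => ?_⟩
  · have h : (4 * n : ℝ) ≤ 3 * cyclicComplexity thueMorse n + 12 := by
      exact_mod_cast ThueMorse.complexity_lower_bound n
    linarith
  · have h : (4 * n : ℝ) ≤ 3 * cyclicComplexity thueMorse n + 6 := by
      exact_mod_cast ThueMorse.complexity_even_lower_bound n hn hJ
    linarith
  · obtain ⟨m, rfl⟩ := hn
    have h : (4 * (2 * m + 1) + 16 : ℝ) ≤ 3 * cyclicComplexity thueMorse (2 * m + 1) := by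
      exact_mod_cast ThueMorse.complexity_odd_lower_bound_of_notMem (m := m) (by omega) hAB
    push_cast
    linarith
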